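/- A planar convex body is a bounded convex set $C\subset\mathbb R^2$ with nonempty interior. Put $\mathbf u(\theta)=(\cos\theta,\sin\theta)$ for $\theta\in\mathbb T_{2\pi}=\mathbb R/2\pi\mathbb Z$, $\delta C=\{\delta\mathbf x:\mathbf x\in C\}$, and $\widehat{\mathbb 1}_\Omega(\boldsymbol\xi)=\int_\Omega e^{-2\pi i\,\mathbf x\cdot\boldsymbol\xi}\,d\mathbf x$. For a boundary point $\mathbf x\in\partial C$ let $$\nu_C(\mathbf x)=\Big\{\theta\in\mathbb T_{2\pi}:\ \mathbf x\cdot\mathbf u(\theta)=\inf_{\mathbf a\in C}\mathbf a\cdot\mathbf u(\theta)\Big\},$$ and for $I\subset\mathbb T_{2\pi}$ let $P_C(I)$ be the length (one-dimensional Hausdorff measure, i.e. arc length along $\partial C$) of $\{\mathbf x\in\partial C:\ \nu_C(\mathbf x)\cap I\neq\varnothing\}$. There are absolute constants $c_1,c_2>0$ such that the following holds for every planar convex body $C$ and every closed interval $I=[\alpha,\beta]\subseteq\mathbb T_{2\pi}$ with $0<\beta-\alpha\le 2\pi$. If $P_C(I)+P_C(I+\pi)>0$, then there is $\rho_0=\rho_0(C,I)$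 such that for all $\rho\ge\rho_0$ $$c_1\,\rho^{-3}\big(P_C(I)+P_C(I+\pi)\big)\ \le\ \int_I\int_0^1\big|\widehat{\mathbb 1}_{\delta C}(\rho\,\mathbf u(\theta))\big|^2\,d\delta\,d\theta\ \le\ c_2\,\rho^{-3}\big(P_C(I)+P_C(I+\pi)\big).$$ If $P_C(I)+P_C(I+\pi)=0$, then $$\lim_{\rho\to+\infty}\rho^{3}\int_I\int_0^1\big|\widehat{\mathbb 1}_{\delta C}(\rho\,\mathbf u(\theta))\big|^2\,d\delta\,d\theta=0.$$ -/

import Mathlib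

open MeasureTheory Filter Topology
open scoped FourierTransform Pointwise

noncomputable section

/-- The Euclidean plane. -/
abbrev Plane : Type := EuclideanSpace ℝ (Fin 2)

/-- A planar convex body: a bounded convex set with nonempty interior. It need not be closed. -/
structure IsPlanarConvexBody (C : Set Plane) : Prop where
  convex : Convex ℝ C
  bounded : Bornology.IsBounded C
  interior_nonempty : (interior C).Nonempty

/-- The unit vector `u(θ) = (cos θ, sin θ)` for an angle `θ ∈ ℝ / 2πℤ`. -/
def unitVec (θ : Real.Angle) : Plane := !₂[θ.cos, θ.sin]

/-- The set of normals of `C` at a boundary point `x`: the angles `θ ∈ ℝ / 2πℤ` such that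
`x · u(θ) = inf_{a ∈ C} a · u(θ)` (a minimum when `C` is closed). -/
def normals (C : Set Plane) (x : Plane) : Set Real.Angle :=
  {θ | IsGLB ((fun a : Plane => inner ℝ a (unitVec θ)) '' C) (inner ℝ x (unitVec θ))}

/-- The portion of perimeter `P_C(I)`: the length (one-dimensional Hausdorff measure, i.e. the
arc-length measure of the curve `∂C`) of the set of boundary points of `C` at which some normal
belongs to `I`. -/
def perimeterPortion (C : Set Plane) (I : Set Real.Angle) : ℝ :=
  (μH[1] : Measure Plane).real {x ∈ frontier C | (normals C x ∩ I).Nonempty}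

/-- The closed interval of angles `[α, β]` modulo `2π`. -/
def angleIcc (α β : ℝ) : Set Real.Angle := (fun t : ℝ => (t : Real.Angle)) '' Set.Icc α β

/-- The Fourier transform of the characteristic function of `Ω`,
`ξ ↦ ∫_Ω exp (-2πi x·ξ) dx`. -/
def charFourier (Ω : Set Plane) (ξ : Plane) : ℂ :=
  𝓕 (Ω.indicator (fun _ => (1 : ℂ))) ξ

/-- The integral over rotations `θ ∈ [α, β]` and dilations `δ ∈ [0, 1]` of the square modulus of
the Fourier transform of the characteristic function of `δC` at `ρ u(θ)`. -/
def fourierAverage (C : Set Plane) (α β ρ : ℝ) : ℝ :=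
  ∫ θ in α..β, ∫ δ in (0 : ℝ)..1, ‖charFourier (δ • C) (ρ • unitVec (θ : Real.Angle))‖ ^ 2

end

open scoped ENNReal

noncomputable section

/-! For fixed `θ`, the transform of the body along the ray in direction `u(θ)` is the
one-dimensional transform of its chord-length function `f`, which is concave on its support `[a,
b]`. Dilation by `δ` contributes a factor `δ²`, so the inner integral is `∫ δ⁴ |𝓕 f (ρδ)|² dδ = ρ⁻⁵
∫₀^ρ r⁴ |𝓕 f r|² dr`. The weight `r⁴` is compared with `16 sin⁴(π r h)`, the multiplier of a second
difference with step `h` of order `1/ρ`. By Plancherel this leaves the squared `L²` norm of the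
second difference, which for a concave profile is comparable to `h (f(a+h) + f(b-h))²`. Hence the
inner integral has the order of `ρ⁻²` times the square of the sum of the two chords at depth about
`1/ρ` below the support lines with normals `±u(θ)`: see `IsConcaveProfile.average_le` and
`IsConcaveProfile.le_average`. The two ends of the profile are the origin of `I` and `I + π`.

It remains to integrate squared chords over `θ`. The gap of a boundary point `z` is its height over
the support line. Its derivative in `θ` is the tangential offset of `z` from the contact point.
Integrating the absolute value of this offset along the part of the boundary with gap less than `δ`
therefore gives offset times length, which is the square of the chord up to constants and an error
`O(δ²)`: see `chord_sq_le` and `integral_slopeMass_le`.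

By Fubini the angular integral may be taken first, at a fixed `z`. It is then the total variation of
`min (gap) δ` over `I`. It is at least `δ` if `z` has a normal in `I` and its gap also reaches `δ`
in `I`. It is zero if the gap never drops below `δ` in `I`. It is at most `2δ` plus a small error,
because the gap is nearly monotone on either side of a normal while it is small. Integration over
the boundary yields `δ P(I)` up to constants and `o(δ)` (`totalMass_asymptotic`), and `δ = 1/ρ`
produces `ρ⁻³`. If `P = 0`, only the `o(δ)` term survives in the upper bound. -/

/-! ### Plancherel's theorem on the line. -/

/-- Both transforms are tested against smooth compactly supported functions, which determine a
locally integrable function. The `L²` transform passes to the test function by definition on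
tempered distributions, the Fourier integral by Fubini. -/
theorem fourier_toLp_ae_eq {f : ℝ → ℂ} (h1 : Integrable f) (h2 : MemLp f 2) :
    ((𝓕 (h2.toLp f) : Lp ℂ 2 (volume : Measure ℝ)) : ℝ → ℂ) =ᵐ[volume] 𝓕 f := by
  have hcont : Continuous (𝓕 f) := by
    exact VectorFourier.fourierIntegral_continuous Real.continuous_fourierChar
      (by exact continuous_inner) h1
  apply ae_eq_of_integral_contDiff_smul_eq
  · exact (Lp.memLp _).locallyIntegrable (by norm_num)
  · exact hcont.locallyIntegrable
  intro g hg hgs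
  have hg' : ContDiff ℝ ((⊤ : ℕ∞) : WithTop ℕ∞) (fun x => (g x : ℂ)) := by
    exact Complex.ofRealCLM.contDiff.comp hg
  have hgs' : HasCompactSupport (fun x => (g x : ℂ)) := hgs.comp_left (g := fun x : ℝ => (x : ℂ)) (by simp)
  set φ : SchwartzMap ℝ ℂ := hgs'.toSchwartzMap hg' with hφ
  have key := congrArg (fun T => T φ) (Lp.fourier_toTemperedDistribution_eq (h2.toLp f))
  simp only [TemperedDistribution.fourier_apply, Lp.toTemperedDistribution_apply] at key
  have e1 : ∫ x, (𝓕 φ) x • (h2.toLp f) x = ∫ x, (𝓕 φ) x • f x := by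
    apply integral_congr_ae
    filter_upwards [h2.coeFn_toLp] with x hx
    rw [hx]
  rw [e1] at key
  have key2 : ∫ ξ, (𝓕 (φ : ℝ → ℂ) ξ) • f ξ = ∫ x, φ x • 𝓕 f x := by
    have hφi : Integrable (fun x => φ x) volume := SchwartzMap.integrable φ
    have := VectorFourier.integral_fourierIntegral_smul_eq_flip (μ := volume) (ν := volume)
      (L := innerₗ ℝ) (f := (φ : ℝ → ℂ)) (g := f) Real.continuous_fourierChar
      (by exact continuous_inner) hφi h1
    rw [flip_innerₗ] at this
    exact this
  rw [SchwartzMap.fourier_coe, key2] at key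
  have hφx : ∀ x, φ x = (g x : ℂ) := fun x => rfl
  simp only [hφx] at key
  simpa using key.symm

/-- Plancherel's theorem for functions in `L¹ ∩ L²`. -/
theorem lintegral_enorm_fourier_sq {f : ℝ → ℂ} (h1 : Integrable f) (h2 : MemLp f 2) :
    ∫⁻ r, ‖𝓕 f r‖ₑ ^ 2 = ∫⁻ x, ‖f x‖ₑ ^ 2 := by
  have e : ‖(𝓕 (h2.toLp f) : Lp ℂ 2 (volume : Measure ℝ))‖ₑ = ‖h2.toLp f‖ₑ := by
    rw [← ofReal_norm, ← ofReal_norm, Lp.norm_fourier_eq]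
  rw [Lp.enorm_def, Lp.enorm_def, eLpNorm_congr_ae (fourier_toLp_ae_eq h1 h2),
    eLpNorm_congr_ae h2.coeFn_toLp, eLpNorm_eq_lintegral_rpow_enorm_toReal (by norm_num) (by norm_num),
    eLpNorm_eq_lintegral_rpow_enorm_toReal (by norm_num) (by norm_num)] at e
  have := congrArg (fun x => x ^ (2 : ℝ)) e
  simp only [ENNReal.toReal_ofNat, ← ENNReal.rpow_mul] at this
  norm_num at this
  exact this

/-! ### Concave profiles and the size of their second differences. -/

/-- A nonnegative function which is concave on `[a, b]` and vanishes outside of it. -/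
structure IsConcaveProfile (f : ℝ → ℝ) (a b : ℝ) : Prop where
  lt : a < b
  concave : ConcaveOn ℝ (Set.Icc a b) f
  nonneg : ∀ x, 0 ≤ f x
  eq_zero : ∀ x, x ∉ Set.Icc a b → f x = 0

/-- The sum of the values of a profile at distance `h` from the endpoints of its support. -/
def endSum (f : ℝ → ℝ) (a b h : ℝ) : ℝ := f (a + h) + f (b - h)

/-- The second forward difference. -/
def secondDiff (f : ℝ → ℝ) (h s : ℝ) : ℝ := f (s + 2 * h) - 2 * f (s + h) + f s

namespace IsConcaveProfile

variable {f : ℝ → ℝ} {a b : ℝ}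

/-- Since `f b ≥ 0`, the graph at `y` lies above the segment from `(x, f x)` to `(b, 0)`. -/
theorem mul_le_left (hf : IsConcaveProfile f a b) {x y : ℝ} (hx : a ≤ x) (hxy : x ≤ y)
    (hy : y ≤ b) : (b - y) * f x ≤ (b - x) * f y := by
  rcases eq_or_lt_of_le (hxy.trans hy) with h | h
  · have h1 : y = b := by linarith
    subst h1; subst h; simp
  have h2 := hf.concave.2 (show x ∈ Set.Icc a b from ⟨hx, by linarith⟩)
    (show b ∈ Set.Icc a b from ⟨hf.lt.le, le_rfl⟩)
    (show 0 ≤ (b - y) / (b - x) from div_nonneg (by linarith) (by linarith))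
    (show 0 ≤ (y - x) / (b - x) from div_nonneg (by linarith) (by linarith))
    (by have : b - x ≠ 0 := by linarith
        field_simp; ring)
  have h3 : ((b - y) / (b - x)) • x + ((y - x) / (b - x)) • b = y := by
    have : b - x ≠ 0 := by linarith
    simp only [smul_eq_mul]; field_simp; ring
  rw [h3] at h2
  have h4 : (b - y) / (b - x) * f x ≤ f y := by
    refine le_trans ?_ h2
    simp only [smul_eq_mul]
    have := mul_nonneg (show 0 ≤ (y - x) / (b - x) from div_nonneg (by linarith) (by linarith))
      (hf.nonneg b)
    linarith
  rw [div_mul_eq_mul_div, div_le_iff₀ (by linarith)] at h4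
  linarith

theorem reflect (hf : IsConcaveProfile f a b) : IsConcaveProfile (fun x => f (a + b - x)) a b where
  lt := hf.lt
  concave := by
    refine ⟨convex_Icc a b, fun x hx y hy s t hs ht hst => ?_⟩
    have := hf.concave.2 (show a + b - x ∈ Set.Icc a b from ⟨by linarith [hx.2], by linarith [hx.1]⟩)
      (show a + b - y ∈ Set.Icc a b from ⟨by linarith [hy.2], by linarith [hy.1]⟩) hs ht hst
    refine this.trans (le_of_eq ?_)
    congr 1
    simp only [smul_eq_mul]
    have : t = 1 - s := by linarith
    subst this; ring
  nonneg x := hf.nonneg _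
  eq_zero x hx := hf.eq_zero _ fun h => hx ⟨by linarith [h.2], by linarith [h.1]⟩

theorem mul_le_right (hf : IsConcaveProfile f a b) {x y : ℝ} (hx : a ≤ x) (hxy : x ≤ y)
    (hy : y ≤ b) : (x - a) * f y ≤ (y - a) * f x := by
  have := hf.reflect.mul_le_left (x := a + b - y) (y := a + b - x) (by linarith) (by linarith)
    (by linarith)
  simp only [sub_sub_cancel] at this
  convert this using 2 <;> ring

/-- The factor 2 bounds `(b - x) / (b - y)` when `y` is in the left half. -/
theorem le_two_mul (hf : IsConcaveProfile f a b) {x y : ℝ} (hx : a ≤ x) (hxy : x ≤ y)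
    (hy : y ≤ (a + b) / 2) : f x ≤ 2 * f y := by
  have hab := hf.lt
  have h1 := hf.mul_le_left hx hxy (by linarith)
  have h2 := hf.nonneg x
  have h3 := hf.nonneg y
  have h4 : (b - y) * f x ≤ (b - y) * (2 * f y) := by nlinarith
  exact le_of_mul_le_mul_left h4 (by linarith)

theorem le_of_near_left (hf : IsConcaveProfile f a b) {h y : ℝ} (h0 : 0 < h) (hh : 4 * h ≤ b - a)
    (hy : y ≤ a + 2 * h) : f y ≤ 2 * f (a + h) := by
  have h2 := hf.nonneg (a + h)
  by_cases hya : a ≤ y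
  · rcases le_total y (a + h) with h1 | h1
    · exact hf.le_two_mul hya h1 (by linarith)
    · have h3 := hf.mul_le_right (show a ≤ a + h by linarith) h1 (by linarith)
      have h4 := hf.nonneg y
      have h5 : h * f y ≤ h * (2 * f (a + h)) := by nlinarith
      exact le_of_mul_le_mul_left h5 h0
  · rw [hf.eq_zero y (fun h => hya h.1)]; linarith

theorem le_of_near_right (hf : IsConcaveProfile f a b) {h y : ℝ} (h0 : 0 < h) (hh : 4 * h ≤ b - a)
    (hy : b - 2 * h ≤ y) : f y ≤ 2 * f (b - h) := by
  have := hf.reflect.le_of_near_left h0 hh (y := a + b - y) (by linarith)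
  simp only [sub_sub_cancel] at this
  convert this using 3; ring

theorem endSum_nonneg (hf : IsConcaveProfile f a b) (h : ℝ) : 0 ≤ endSum f a b h :=
  add_nonneg (hf.nonneg _) (hf.nonneg _)

theorem endSum_le (hf : IsConcaveProfile f a b) {h k : ℝ} (h0 : 0 ≤ h) (hk : h ≤ k)
    (hh : 2 * k ≤ b - a) : endSum f a b h ≤ 2 * endSum f a b k := by
  have h1 := hf.le_two_mul (x := a + h) (y := a + k) (by linarith) (by linarith) (by linarith)
  have h2 := hf.reflect.le_two_mul (x := a + h) (y := a + k) (by linarith) (by linarith)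
    (by linarith)
  have e1 : a + b - (a + h) = b - h := by ring
  have e2 : a + b - (a + k) = b - k := by ring
  simp only [e1, e2] at h2
  unfold endSum; linarith

theorem le_bound (hf : IsConcaveProfile f a b) (x : ℝ) : f x ≤ 2 * f ((a + b) / 2) := by
  by_cases hx : x ∈ Set.Icc a b
  · rcases le_total x ((a + b) / 2) with h | h
    · exact hf.le_two_mul hx.1 h le_rfl
    · have := hf.reflect.le_two_mul (x := a + b - x) (y := (a + b) / 2) (by linarith [hx.2])
        (by linarith) le_rfl
      simp only [sub_sub_cancel] at this
      convert this using 3; ring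
  · rw [hf.eq_zero x hx]; linarith [hf.nonneg ((a + b) / 2)]

theorem aestronglyMeasurable (hf : IsConcaveProfile f a b) : AEStronglyMeasurable f volume := by
  have hc : ContinuousOn f (Set.Ioo a b) := by
    have := hf.concave.continuousOn_interior
    rwa [interior_Icc] at this
  have h1 : AEStronglyMeasurable ((Set.Ioo a b).indicator f) volume := by
    rw [aestronglyMeasurable_indicator_iff measurableSet_Ioo]
    exact hc.aestronglyMeasurable measurableSet_Ioo
  refine h1.congr ?_
  have : ∀ᵐ x : ℝ, x ∉ ({a, b} : Set ℝ) :=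
    measure_eq_zero_iff_ae_notMem.1 ((Set.toFinite {a, b}).measure_zero volume)
  filter_upwards [this] with x hx
  simp only [Set.mem_insert_iff, Set.mem_singleton_iff, not_or] at hx
  by_cases h : x ∈ Set.Ioo a b
  · rw [Set.indicator_of_mem h]
  · rw [Set.indicator_of_notMem h, hf.eq_zero x]
    rintro ⟨h1, h2⟩
    exact h ⟨lt_of_le_of_ne h1 (Ne.symm hx.1), lt_of_le_of_ne h2 hx.2⟩

theorem memLp (hf : IsConcaveProfile f a b) (p : ℝ≥0∞) : MemLp f p volume := by
  have h1 : MemLp f p (volume.restrict (Set.Icc a b)) :=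
    MemLp.of_bound hf.aestronglyMeasurable.restrict (2 * f ((a + b) / 2))
      (ae_of_all _ fun x => by
        rw [Real.norm_of_nonneg (hf.nonneg x)]; exact hf.le_bound x)
  rw [← memLp_indicator_iff_restrict measurableSet_Icc] at h1
  convert h1 using 1
  ext x
  by_cases h : x ∈ Set.Icc a b
  · rw [Set.indicator_of_mem h]
  · rw [Set.indicator_of_notMem h, hf.eq_zero x h]

theorem integrable (hf : IsConcaveProfile f a b) : Integrable f volume :=
  memLp_one_iff_integrable.1 (hf.memLp 1)

theorem memLp_secondDiff (hf : IsConcaveProfile f a b) (p : ℝ≥0∞) (h : ℝ) :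
    MemLp (secondDiff f h) p volume := by
  have key : ∀ c : ℝ, MemLp (fun s => f (s + c)) p volume := fun c =>
    (hf.memLp p).comp_measurePreserving (measurePreserving_add_right volume c)
  exact ((key (2 * h)).sub ((key h).const_mul 2)).add (hf.memLp p)

/-- The increments of a concave function over steps of length `h` decrease. They thus lie between
the last, `f b - f (b - h)`, and the first, `f (a + h) - f a`. -/
theorem secondDiff_bounds (hf : IsConcaveProfile f a b) {h : ℝ} (h0 : 0 < h)
    {s : ℝ} (hs : a ≤ s) (hs' : s + 2 * h ≤ b) :
    secondDiff f h s ≤ 0 ∧ -endSum f a b h ≤ secondDiff f h s := by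
  have incr : ∀ x y : ℝ, a ≤ x → x ≤ y → y + h ≤ b → f (y + h) - f y ≤ f (x + h) - f x := by
    intro x y h1 h2 h3
    have hL : 0 < y - x + h := by linarith
    have mx : x ∈ Set.Icc a b := ⟨h1, by linarith⟩
    have my : y + h ∈ Set.Icc a b := ⟨by linarith, h3⟩
    have p1 : 0 ≤ (y - x) / (y - x + h) := div_nonneg (by linarith) hL.le
    have p2 : 0 ≤ h / (y - x + h) := div_nonneg h0.le hL.le
    have p3 : (y - x) / (y - x + h) + h / (y - x + h) = 1 := by field_simp
    have c1 := hf.concave.2 mx my p1 p2 p3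
    have c2 := hf.concave.2 mx my p2 p1 (by linarith)
    have q1 : ((y - x) / (y - x + h)) • x + (h / (y - x + h)) • (y + h) = x + h := by
      simp only [smul_eq_mul]; field_simp; ring
    have q2 : (h / (y - x + h)) • x + ((y - x) / (y - x + h)) • (y + h) = y := by
      simp only [smul_eq_mul]; field_simp; ring
    rw [q1] at c1
    rw [q2] at c2
    simp only [smul_eq_mul] at c1 c2
    have r1 : (y - x) / (y - x + h) = 1 - h / (y - x + h) := by linarith
    rw [r1] at c1 c2
    linarith
  have e1 : s + h + h = s + 2 * h := by ring
  have i1 := incr s (s + h) hs (by linarith) (by linarith)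
  have i2 := incr a s le_rfl hs (by linarith)
  have i3 := incr (s + h) (b - h) (by linarith) (by linarith) (by linarith)
  rw [e1] at i1 i3
  rw [sub_add_cancel] at i3
  have := hf.nonneg a
  have := hf.nonneg b
  unfold secondDiff endSum
  constructor <;> linarith

/-- The three translated integrals cancel except on four intervals of length `h` near the endpoints.
Two of them enter with a minus sign and are dropped; on the others `f` is at most twice its value at
depth `h`. -/
theorem integral_neg_secondDiff_le (hf : IsConcaveProfile f a b) {h : ℝ} (h0 : 0 < h)
    (hh : 4 * h ≤ b - a) :
    ∫ s in a..(b - 2 * h), -secondDiff f h s ≤ 2 * h * endSum f a b h := by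
  have hi : ∀ x y : ℝ, IntervalIntegrable f volume x y := fun x y =>
    hf.integrable.intervalIntegrable
  have hi' : ∀ c x y : ℝ, IntervalIntegrable (fun s => f (s + c)) volume x y := fun c x y =>
    (hf.integrable.comp_add_right c).intervalIntegrable
  have e : ∫ s in a..(b - 2 * h), -secondDiff f h s
      = 2 * (∫ s in (a + h)..(b - h), f s) - (∫ s in a..(b - 2 * h), f s)
        - ∫ s in (a + 2 * h)..b, f s := by
    have : (fun s => -secondDiff f h s) = fun s => 2 * f (s + h) - f s - f (s + 2 * h) := by
      ext s; unfold secondDiff; ring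
    rw [this, intervalIntegral.integral_sub (((hi' h _ _).const_mul 2).sub (hi _ _)) (hi' _ _ _),
      intervalIntegral.integral_sub ((hi' h _ _).const_mul 2) (hi _ _),
      intervalIntegral.integral_const_mul, intervalIntegral.integral_comp_add_right,
      intervalIntegral.integral_comp_add_right]
    congr 2 <;> congr 2 <;> ring
  have s1 := intervalIntegral.integral_add_adjacent_intervals (hi a (a + h)) (hi (a + h) (a + 2 * h))
  have s2 := intervalIntegral.integral_add_adjacent_intervals (hi a (a + 2 * h))
    (hi (a + 2 * h) (b - 2 * h))
  have s3 := intervalIntegral.integral_add_adjacent_intervals (hi (a + h) (a + 2 * h))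
    (hi (a + 2 * h) (b - 2 * h))
  have s4 := intervalIntegral.integral_add_adjacent_intervals (hi (a + h) (b - 2 * h))
    (hi (b - 2 * h) (b - h))
  have s5 := intervalIntegral.integral_add_adjacent_intervals (hi (a + 2 * h) (b - 2 * h))
    (hi (b - 2 * h) (b - h))
  have s6 := intervalIntegral.integral_add_adjacent_intervals (hi (a + 2 * h) (b - h))
    (hi (b - h) b)
  have n1 : 0 ≤ ∫ s in a..(a + h), f s :=
    intervalIntegral.integral_nonneg (by linarith) fun u _ => hf.nonneg u
  have n2 : 0 ≤ ∫ s in (b - h)..b, f s :=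
    intervalIntegral.integral_nonneg (by linarith) fun u _ => hf.nonneg u
  have u1 : ∫ s in (a + h)..(a + 2 * h), f s ≤ ∫ s in (a + h)..(a + 2 * h), 2 * f (a + h) :=
    intervalIntegral.integral_mono_on (by linarith) (hi _ _) (by simp) fun x hx =>
      hf.le_of_near_left h0 hh hx.2
  have u2 : ∫ s in (b - 2 * h)..(b - h), f s ≤ ∫ s in (b - 2 * h)..(b - h), 2 * f (b - h) :=
    intervalIntegral.integral_mono_on (by linarith) (hi _ _) (by simp) fun x hx =>
      hf.le_of_near_right h0 hh hx.1
  rw [intervalIntegral.integral_const, smul_eq_mul] at u1 u2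
  rw [e]
  unfold endSum
  nlinarith

/-- With `A` the end sum, the second difference `d` satisfies `0 ≤ -d ≤ A` in the middle, so `d² ≤ A
(-d)`, whose integral is at most `2hA²` whatever the length of the support. On the two end windows
of length `2h` one has `|d| ≤ 4A`, and `66 = 32 + 2 + 32`. -/
theorem integral_secondDiff_sq_le (hf : IsConcaveProfile f a b) {h : ℝ} (h0 : 0 < h)
    (hh : 4 * h ≤ b - a) :
    ∫ s, secondDiff f h s ^ 2 ≤ 66 * h * endSum f a b h ^ 2 := by
  set A := endSum f a b h with hA
  have hA0 : 0 ≤ A := hf.endSum_nonneg h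
  have hfa : f (a + h) ≤ A := by have := hf.nonneg (b - h); rw [hA]; unfold endSum; linarith
  have hfb : f (b - h) ≤ A := by have := hf.nonneg (a + h); rw [hA]; unfold endSum; linarith
  set S1 := Set.Icc (a - 2 * h) a
  set S2 := Set.Ioc a (b - 2 * h)
  set S3 := Set.Icc (b - 2 * h) b
  have hD : Integrable (secondDiff f h) := memLp_one_iff_integrable.1 (hf.memLp_secondDiff 1 h)
  have dom : ∀ s, secondDiff f h s ^ 2 ≤ S1.indicator (fun _ => 16 * A ^ 2) s
      + S2.indicator (fun s => A * -secondDiff f h s) s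
      + S3.indicator (fun _ => 16 * A ^ 2) s := by
    intro s
    have p1 : 0 ≤ S1.indicator (fun _ => 16 * A ^ 2) s :=
      Set.indicator_nonneg (fun _ _ => by positivity) _
    have p3 : 0 ≤ S3.indicator (fun _ => 16 * A ^ 2) s :=
      Set.indicator_nonneg (fun _ _ => by positivity) _
    have p2 : 0 ≤ S2.indicator (fun s => A * -secondDiff f h s) s :=
      Set.indicator_nonneg (fun x hx => mul_nonneg hA0 (by
        have := (hf.secondDiff_bounds h0 hx.1.le (by linarith [hx.2])).1
        linarith)) _
    have m1 := hf.nonneg s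
    have m2 := hf.nonneg (s + h)
    have m3 := hf.nonneg (s + 2 * h)
    by_cases c1 : s ∈ S1
    · have t1 := hf.le_of_near_left h0 hh (y := s) (by linarith [c1.2])
      have t2 := hf.le_of_near_left h0 hh (y := s + h) (by linarith [c1.2])
      have t3 := hf.le_of_near_left h0 hh (y := s + 2 * h) (by linarith [c1.2])
      have : secondDiff f h s ^ 2 ≤ (4 * A) ^ 2 := by
        apply sq_le_sq'
        · unfold secondDiff; linarith
        · unfold secondDiff; linarith
      rw [Set.indicator_of_mem c1]; linarith
    by_cases c3 : s ∈ S3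
    · have t1 := hf.le_of_near_right h0 hh (y := s) (by linarith [c3.1])
      have t2 := hf.le_of_near_right h0 hh (y := s + h) (by linarith [c3.1])
      have t3 := hf.le_of_near_right h0 hh (y := s + 2 * h) (by linarith [c3.1])
      have : secondDiff f h s ^ 2 ≤ (4 * A) ^ 2 := by
        apply sq_le_sq'
        · unfold secondDiff; linarith
        · unfold secondDiff; linarith
      rw [Set.indicator_of_mem c3]; linarith
    by_cases c2 : s ∈ S2
    · rw [Set.indicator_of_mem c2]
      obtain ⟨q1, q2⟩ := hf.secondDiff_bounds h0 c2.1.le (by linarith [c2.2])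
      nlinarith
    have z : s < a - 2 * h ∨ b < s := by
      by_contra hcon
      push Not at hcon
      rcases le_or_gt s a with g1 | g1
      · exact c1 ⟨hcon.1, g1⟩
      rcases le_or_gt s (b - 2 * h) with g2 | g2
      · exact c2 ⟨g1, g2⟩
      · exact c3 ⟨g2.le, hcon.2⟩
    have hz : secondDiff f h s = 0 := by
      unfold secondDiff
      rcases z with z | z
      · rw [hf.eq_zero s (fun h => by linarith [h.1]), hf.eq_zero (s + h) (fun h => by linarith [h.1]),
          hf.eq_zero (s + 2 * h) (fun h => by linarith [h.1])]; ring
      · rw [hf.eq_zero s (fun h => by linarith [h.2]), hf.eq_zero (s + h) (fun h => by linarith [h.2]),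
          hf.eq_zero (s + 2 * h) (fun h => by linarith [h.2])]; ring
    rw [hz]
    simp only [ne_eq, OfNat.ofNat_ne_zero, not_false_eq_true, zero_pow]
    linarith
  have i1 : Integrable (S1.indicator (fun _ : ℝ => 16 * A ^ 2)) :=
    (integrable_indicator_iff measurableSet_Icc).2 (integrableOn_const measure_Icc_lt_top.ne)
  have i3 : Integrable (S3.indicator (fun _ : ℝ => 16 * A ^ 2)) :=
    (integrable_indicator_iff measurableSet_Icc).2 (integrableOn_const measure_Icc_lt_top.ne)
  have i2 : Integrable (S2.indicator (fun s => A * -secondDiff f h s)) :=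
    (hD.neg.const_mul A).indicator measurableSet_Ioc
  have hab := hf.lt
  calc ∫ s, secondDiff f h s ^ 2 ≤ ∫ s, (S1.indicator (fun _ => 16 * A ^ 2) s
      + S2.indicator (fun s => A * -secondDiff f h s) s
      + S3.indicator (fun _ => 16 * A ^ 2) s) :=
        integral_mono (hf.memLp_secondDiff 2 h).integrable_sq ((i1.add i2).add i3) dom
    _ = (2 * h) * (16 * A ^ 2) + A * (∫ s in a..(b - 2 * h), -secondDiff f h s)
        + (2 * h) * (16 * A ^ 2) := by
        have e1 := integral_add (i1.add i2) i3
        have e2 := integral_add i1 i2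
        simp only [Pi.add_apply] at e1
        rw [e1, e2, integral_indicator measurableSet_Icc,
          integral_indicator measurableSet_Icc, integral_indicator measurableSet_Ioc,
          setIntegral_const, setIntegral_const,
          intervalIntegral.integral_of_le (show a ≤ b - 2 * h by linarith), integral_const_mul]
        simp only [Real.volume_real_Icc, smul_eq_mul]
        rw [max_eq_left (by linarith), max_eq_left (by linarith)]
        ring
    _ ≤ 66 * h * A ^ 2 := by
        have := mul_le_mul_of_nonneg_left (hf.integral_neg_secondDiff_le h0 hh) hA0
        rw [← hA] at this
        linarith

/-- Where only one of the three sample points falls inside the support, the second difference is a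
single value of `f`. Over a window of length `h / 2` at each end this value is at least half of `f
(a + h)`, respectively `f (b - h)`. -/
theorem le_integral_secondDiff_sq (hf : IsConcaveProfile f a b) {h : ℝ} (h0 : 0 < h)
    (hh : 4 * h ≤ b - a) :
    h / 32 * endSum f a b h ^ 2 ≤ ∫ s, secondDiff f h s ^ 2 := by
  have hab := hf.lt
  have hsq : Integrable (fun s => secondDiff f h s ^ 2) := (hf.memLp_secondDiff 2 h).integrable_sq
  have key : ∀ c B : ℝ, 0 ≤ B → (∀ s ∈ Set.Ioo c (c + h / 2), B / 2 ≤ secondDiff f h s) →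
      h / 8 * B ^ 2 ≤ ∫ s, secondDiff f h s ^ 2 := by
    intro c B hB hs
    calc h / 8 * B ^ 2 = ∫ s in Set.Ioo c (c + h / 2), (B / 2) ^ 2 := by
          rw [setIntegral_const, Real.volume_real_Ioo, max_eq_left (by linarith), smul_eq_mul]; ring
      _ ≤ ∫ s in Set.Ioo c (c + h / 2), secondDiff f h s ^ 2 := by
          refine setIntegral_mono_on (integrableOn_const (by simp)) hsq.integrableOn measurableSet_Ioo
            fun s hx => ?_
          have := hs s hx
          exact pow_le_pow_left₀ (by linarith) this 2
      _ ≤ _ := setIntegral_le_integral hsq (ae_of_all _ fun s => sq_nonneg _)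
  have k1 := key (a - 3 / 2 * h) (f (a + h)) (hf.nonneg _) (by
    intro s hs
    have := hf.mul_le_right (x := s + 2 * h) (y := a + h) (by linarith [hs.1]) (by linarith [hs.2])
      (by linarith)
    have hp := hf.nonneg (a + h)
    unfold secondDiff
    rw [hf.eq_zero (s + h) (fun h => by linarith [h.1, hs.2]),
      hf.eq_zero s (fun h => by linarith [h.1, hs.2])]
    have h1 : h * (f (a + h) / 2) ≤ h * f (s + 2 * h) := by nlinarith [hs.1]
    have := le_of_mul_le_mul_left h1 h0
    linarith)
  have k2 := key (b - h) (f (b - h)) (hf.nonneg _) (by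
    intro s hs
    have := hf.mul_le_left (x := b - h) (y := s) (by linarith) (by linarith [hs.1])
      (by linarith [hs.2])
    have hp := hf.nonneg (b - h)
    unfold secondDiff
    rw [hf.eq_zero (s + h) (fun h => by linarith [h.2, hs.1]),
      hf.eq_zero (s + 2 * h) (fun h => by linarith [h.2, hs.1])]
    have h1 : h * (f (b - h) / 2) ≤ h * f s := by nlinarith [hs.2]
    have := le_of_mul_le_mul_left h1 h0
    linarith)
  unfold endSum
  nlinarith [mul_nonneg h0.le (sq_nonneg (f (a + h) - f (b - h)))]

end IsConcaveProfile

/-! ### Dilation averages of the spectral energy of a concave profile. -/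

/-- The energy density `|𝓕 f|²` of a real function. -/
def spectralEnergy (f : ℝ → ℝ) (r : ℝ) : ℝ := ‖𝓕 (fun x => (f x : ℂ)) r‖ ^ 2

theorem spectralEnergy_nonneg (f : ℝ → ℝ) (r : ℝ) : 0 ≤ spectralEnergy f r := sq_nonneg _

theorem spectralEnergy_neg (f : ℝ → ℝ) (r : ℝ) :
    spectralEnergy f (-r) = spectralEnergy f r := by
  unfold spectralEnergy
  congr 1
  rw [Real.fourier_real_eq, Real.fourier_real_eq, ← Complex.norm_conj, ← integral_conj]
  congr 2
  ext v
  rw [Circle.smul_def, Circle.smul_def, smul_eq_mul, smul_eq_mul, map_mul, Complex.conj_ofReal,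
    ← Circle.coe_inv_eq_conj, ← AddChar.map_neg_eq_inv]
  congr 3
  ring

theorem continuous_fourier_of_integrable {f : ℝ → ℂ} (h1 : Integrable f) : Continuous (𝓕 f) :=
  VectorFourier.fourierIntegral_continuous Real.continuous_fourierChar
    (by exact continuous_inner) h1

theorem norm_sq_fourier_integrable {f : ℝ → ℂ} (h1 : Integrable f) (h2 : MemLp f 2) :
    Integrable (fun r => ‖𝓕 f r‖ ^ 2) := by
  have hm := (continuous_fourier_of_integrable h1)
  rw [← memLp_two_iff_integrable_sq_norm hm.aestronglyMeasurable]
  exact (memLp_congr_ae (fourier_toLp_ae_eq h1 h2)).1 (Lp.memLp _)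

theorem integral_norm_sq_fourier {f : ℝ → ℂ} (h1 : Integrable f) (h2 : MemLp f 2) :
    ∫ r, ‖𝓕 f r‖ ^ 2 = ∫ x, ‖f x‖ ^ 2 := by
  have hm := (continuous_fourier_of_integrable h1)
  rw [integral_eq_lintegral_of_nonneg_ae (ae_of_all _ fun r => sq_nonneg _)
      (hm.norm.pow 2).aestronglyMeasurable,
    integral_eq_lintegral_of_nonneg_ae (ae_of_all _ fun r => sq_nonneg _)
      (h1.aestronglyMeasurable.norm.pow 2)]
  have := lintegral_enorm_fourier_sq h1 h2
  simp only [← ofReal_norm, ← ENNReal.ofReal_pow (norm_nonneg _)] at this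
  rw [this]

theorem norm_fourierChar_sub_one (x : ℝ) :
    ‖((Real.fourierChar x : Circle) : ℂ) - 1‖ = 2 * |Real.sin (Real.pi * x)| := by
  rw [Real.fourierChar_apply, mul_comm, Complex.norm_exp_I_mul_ofReal_sub_one, norm_mul,
    Real.norm_eq_abs, Real.norm_eq_abs]
  congr 2
  · norm_num
  · congr 1; ring

/-- The mean of `sin⁴` is `3/8`. The oscillating part of the explicit primitive costs at most `1/12
+ 1/96`, because `π x ≥ 3`. -/
theorem one_fourth_le_integral_sin_pow_four {x : ℝ} (hx : 1 ≤ x) :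
    1 / 4 ≤ ∫ t in (0 : ℝ)..1, Real.sin (Real.pi * x * t) ^ 4 := by
  have hpi := Real.pi_gt_three
  have hpx : 3 ≤ Real.pi * x := by nlinarith
  have hd : ∀ t ∈ Set.uIcc (0 : ℝ) 1, HasDerivAt (fun t => 3 / 8 * t
      - Real.sin (2 * (Real.pi * x * t)) / (4 * (Real.pi * x))
      + Real.sin (4 * (Real.pi * x * t)) / (32 * (Real.pi * x)))
      (Real.sin (Real.pi * x * t) ^ 4) t := by
    intro t _
    have h1 : HasDerivAt (fun t : ℝ => 2 * (Real.pi * x * t)) (2 * (Real.pi * x)) t := by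
      simpa using ((hasDerivAt_id t).const_mul (Real.pi * x)).const_mul 2
    have h2 : HasDerivAt (fun t : ℝ => 4 * (Real.pi * x * t)) (4 * (Real.pi * x)) t := by
      simpa using ((hasDerivAt_id t).const_mul (Real.pi * x)).const_mul 4
    have h3 := (((hasDerivAt_id t).const_mul (3 / 8)).sub (h1.sin.div_const (4 * (Real.pi * x)))).add
      (h2.sin.div_const (32 * (Real.pi * x)))
    refine h3.congr_deriv ?_
    have e1 : Real.cos (4 * (Real.pi * x * t)) = 2 * Real.cos (2 * (Real.pi * x * t)) ^ 2 - 1 := by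
      rw [← Real.cos_two_mul]; congr 1; ring
    have e2 : Real.cos (2 * (Real.pi * x * t)) = 1 - 2 * Real.sin (Real.pi * x * t) ^ 2 := by
      rw [Real.cos_two_mul, Real.cos_sq']; ring
    rw [e1, e2]
    have : Real.pi * x ≠ 0 := by linarith
    field_simp
    ring
  rw [intervalIntegral.integral_eq_sub_of_hasDerivAt hd
    (Continuous.intervalIntegrable (by fun_prop) _ _)]
  have b1 : Real.sin (2 * (Real.pi * x * 1)) / (4 * (Real.pi * x)) ≤ 1 / 12 := by
    rw [div_le_div_iff₀ (by linarith) (by norm_num)]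
    nlinarith [Real.sin_le_one (2 * (Real.pi * x * 1))]
  have b2 : -(1 / 96) ≤ Real.sin (4 * (Real.pi * x * 1)) / (32 * (Real.pi * x)) := by
    rw [le_div_iff₀ (by linarith)]
    nlinarith [Real.neg_one_le_sin (4 * (Real.pi * x * 1))]
  simp only [mul_zero, Real.sin_zero, zero_div]
  linarith

namespace IsConcaveProfile

variable {f : ℝ → ℝ} {a b : ℝ}

theorem integrable_spectralEnergy (hf : IsConcaveProfile f a b) :
    Integrable (spectralEnergy f) :=
  norm_sq_fourier_integrable hf.integrable.ofReal (hf.memLp 2).ofReal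

theorem continuous_spectralEnergy (hf : IsConcaveProfile f a b) :
    Continuous (spectralEnergy f) :=
  (continuous_fourier_of_integrable hf.integrable.ofReal).norm.pow 2

/-- The second difference acts as the multiplier `(e^{2πirh} - 1)²`, and `|e^{2πirh} - 1| = 2
|sin(πrh)|`. -/
theorem fourier_secondDiff (hf : IsConcaveProfile f a b) (h r : ℝ) :
    ‖𝓕 (fun x => (secondDiff f h x : ℂ)) r‖ ^ 2
      = spectralEnergy f r * (16 * Real.sin (Real.pi * (r * h)) ^ 4) := by
  set F : ℝ → ℂ := fun x => (f x : ℂ)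
  have hF : Integrable F := hf.integrable.ofReal
  have tr : ∀ c : ℝ, 𝓕 (fun x => F (x + c)) r = (Real.fourierChar (r * c) : ℂ) * 𝓕 F r := by
    intro c
    have := congrFun (VectorFourier.fourierIntegral_comp_add_right Real.fourierChar volume
      (innerₗ ℝ) F c) r
    have e : (innerₗ ℝ) c r = r * c := by simp [innerₗ_apply_apply]
    rw [e] at this
    exact this
  have sm : 𝓕 (fun x => (secondDiff f h x : ℂ)) r
      = ((Real.fourierChar (r * h) : ℂ) - 1) ^ 2 * 𝓕 F r := by
    have e1 : (fun x => (secondDiff f h x : ℂ))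
        = ((fun x => F (x + 2 * h)) - (2 : ℂ) • fun x => F (x + h)) + F := by
      ext x; simp [secondDiff, F]
    have i1 : Integrable (fun x => F (x + 2 * h)) := hF.comp_add_right _
    have i2 : Integrable (fun x => F (x + h)) := hF.comp_add_right _
    have lin1 : ∀ g k : ℝ → ℂ, Integrable g → Integrable k → 𝓕 (g + k) r = 𝓕 g r + 𝓕 k r := by
      intro g k hg hk
      have := congrFun (VectorFourier.fourierIntegral_add (L := innerₗ ℝ)
        Real.continuous_fourierChar (by exact continuous_inner) hg hk) r
      exact this
    have lin2 : ∀ (c : ℂ) (g : ℝ → ℂ), 𝓕 (c • g) r = c * 𝓕 g r := by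
      intro c g
      exact congrFun (VectorFourier.fourierIntegral_const_smul Real.fourierChar volume
        (innerₗ ℝ) g c) r
    rw [e1, sub_eq_add_neg, ← neg_smul, lin1 _ _ (i1.add (i2.smul _)) hF, lin1 _ _ i1 (i2.smul _),
      lin2, tr, tr]
    have : (Real.fourierChar (r * (2 * h)) : ℂ) = (Real.fourierChar (r * h) : ℂ) ^ 2 := by
      rw [show r * (2 * h) = r * h + r * h by ring, AddChar.map_add_eq_mul, Circle.coe_mul]; ring
    rw [this]; ring
  rw [sm, norm_mul, norm_pow, norm_fourierChar_sub_one]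
  unfold spectralEnergy
  have : |Real.sin (Real.pi * (r * h))| ^ 4 = Real.sin (Real.pi * (r * h)) ^ 4 :=
    Even.pow_abs (by decide) _
  calc _ = ‖𝓕 F r‖ ^ 2 * (16 * |Real.sin (Real.pi * (r * h))| ^ 4) := by ring
    _ = _ := by rw [this]

theorem integral_spectralEnergy_mul (hf : IsConcaveProfile f a b) (h : ℝ) :
    ∫ r, spectralEnergy f r * (16 * Real.sin (Real.pi * (r * h)) ^ 4)
      = ∫ s, secondDiff f h s ^ 2 := by
  have := integral_norm_sq_fourier (f := fun x => (secondDiff f h x : ℂ))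
    (memLp_one_iff_integrable.1 (hf.memLp_secondDiff 1 h)).ofReal (hf.memLp_secondDiff 2 h).ofReal
  simp only [hf.fourier_secondDiff] at this
  rw [this]
  congr 1
  ext x
  simp

theorem integrable_spectralEnergy_mul (hf : IsConcaveProfile f a b) (h : ℝ) :
    Integrable fun r => spectralEnergy f r * (16 * Real.sin (Real.pi * (r * h)) ^ 4) := by
  refine hf.integrable_spectralEnergy.mul_bdd (c := 16) (by fun_prop) (ae_of_all _ fun r => ?_)
  rw [Real.norm_of_nonneg (by positivity)]
  have : Real.sin (Real.pi * (r * h)) ^ 4 ≤ 1 := by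
    have := Real.sin_sq_le_one (Real.pi * (r * h))
    nlinarith [sq_nonneg (Real.sin (Real.pi * (r * h)))]
  linarith

theorem integral_pow_four_scale (f : ℝ → ℝ) {ρ : ℝ} (hρ : 0 < ρ) :
    ∫ δ in (0 : ℝ)..1, δ ^ 4 * spectralEnergy f (ρ * δ)
      = ρ⁻¹ ^ 5 * ∫ r in (0 : ℝ)..ρ, r ^ 4 * spectralEnergy f r := by
  have h1 := intervalIntegral.integral_comp_mul_left (a := 0) (b := 1)
    (fun r => r ^ 4 * spectralEnergy f r) hρ.ne'
  simp only [mul_zero, mul_one, smul_eq_mul] at h1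
  have h2 : (fun δ => δ ^ 4 * spectralEnergy f (ρ * δ))
      = fun δ => ρ⁻¹ ^ 4 * ((ρ * δ) ^ 4 * spectralEnergy f (ρ * δ)) := by
    ext δ; field_simp
  rw [h2, intervalIntegral.integral_const_mul, h1]
  ring

/-- Upper bound for the dilation average of the Fourier transform of a concave profile. -/
theorem average_le (hf : IsConcaveProfile f a b) {ρ : ℝ} (hρ : 0 < ρ) (hh : 2 ≤ ρ * (b - a)) :
    ∫ δ in (0 : ℝ)..1, δ ^ 4 * spectralEnergy f (ρ * δ)
      ≤ 3 * ρ⁻¹ ^ 2 * endSum f a b (1 / (2 * ρ)) ^ 2 := by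
  set h := 1 / (2 * ρ) with hh'
  have h0 : 0 < h := by positivity
  have hle : 4 * h ≤ b - a := by
    rw [hh']; rw [← mul_div_assoc, div_le_iff₀ (by positivity)]; linarith
  have hc := hf.continuous_spectralEnergy
  have step : ∫ r in (0 : ℝ)..ρ, r ^ 4 * spectralEnergy f r
      ≤ ρ ^ 4 / 16 * ∫ s, secondDiff f h s ^ 2 := by
    rw [← hf.integral_spectralEnergy_mul h, ← integral_const_mul,
      intervalIntegral.integral_of_le hρ.le]
    have i2 := (hf.integrable_spectralEnergy_mul h).const_mul (ρ ^ 4 / 16)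
    refine le_trans (setIntegral_mono_on ?_ i2.integrableOn measurableSet_Ioc
      fun r hr => ?_) (setIntegral_le_integral i2 (ae_of_all _ fun r => ?_))
    · exact (Continuous.integrableOn_Icc (by fun_prop)).mono_set Set.Ioc_subset_Icc_self
    · have e : Real.pi * (r * h) = Real.pi / 2 * (r / ρ) := by rw [hh']; field_simp
      -- Jordan's inequality; `h = 1/(2ρ)` places the argument in `[0, π/2]` exactly for `r` up to
      -- `ρ`.
      have s1 : r / ρ ≤ Real.sin (Real.pi * (r * h)) := by
        rw [e]
        have := Real.mul_le_sin (x := Real.pi / 2 * (r / ρ))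
          (mul_nonneg (by positivity) (div_nonneg hr.1.le hρ.le))
          (by
            have : r / ρ ≤ 1 := (div_le_one hρ).2 hr.2
            nlinarith [Real.pi_pos])
        refine le_trans (le_of_eq ?_) this
        field_simp
      have s2 : (r / ρ) ^ 4 ≤ Real.sin (Real.pi * (r * h)) ^ 4 :=
        pow_le_pow_left₀ (div_nonneg hr.1.le hρ.le) s1 4
      have s3 : r ^ 4 ≤ ρ ^ 4 * Real.sin (Real.pi * (r * h)) ^ 4 := by
        rw [div_pow, div_le_iff₀ (by positivity)] at s2; linarith
      calc r ^ 4 * spectralEnergy f r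
          ≤ (ρ ^ 4 * Real.sin (Real.pi * (r * h)) ^ 4) * spectralEnergy f r :=
            mul_le_mul_of_nonneg_right s3 (spectralEnergy_nonneg f r)
        _ = _ := by ring
    · have := spectralEnergy_nonneg f r
      positivity
  rw [integral_pow_four_scale f hρ]
  have up := hf.integral_secondDiff_sq_le h0 hle
  have sq := sq_nonneg (endSum f a b h)
  calc ρ⁻¹ ^ 5 * ∫ r in (0 : ℝ)..ρ, r ^ 4 * spectralEnergy f r
      ≤ ρ⁻¹ ^ 5 * (ρ ^ 4 / 16 * (66 * h * endSum f a b h ^ 2)) := by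
        gcongr
        linarith [mul_le_mul_of_nonneg_left up (show 0 ≤ ρ ^ 4 / 16 by positivity)]
    _ = 66 / 32 * ρ⁻¹ ^ 2 * endSum f a b h ^ 2 := by rw [hh']; field_simp; ring
    _ ≤ _ := by gcongr; norm_num

/-- For a single step the multiplier `16 sin⁴` has zeros at high frequencies. Averaged over the
steps `t/ρ` with `t` in `(0, 1]`, it is at least 4 when `|r| > ρ`, while each step has
second-difference norm controlled by the end sum at `1/ρ`. -/
theorem tail_le (hf : IsConcaveProfile f a b) {ρ : ℝ} (hρ : 0 < ρ) (hh : 4 ≤ ρ * (b - a)) :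
    ∫ r in {r : ℝ | ρ < |r|}, spectralEnergy f r ≤ 66 / ρ * endSum f a b (1 / ρ) ^ 2 := by
  set A := endSum f a b (1 / ρ)
  set S := {r : ℝ | ρ < |r|}
  have hS : MeasurableSet S := measurableSet_lt measurable_const (by fun_prop)
  have hE := hf.integrable_spectralEnergy
  set G : ℝ → ℝ → ℝ := fun t r => spectralEnergy f r * (16 * Real.sin (Real.pi * (r * (t / ρ))) ^ 4)
  have hsin : ∀ x : ℝ, Real.sin x ^ 4 ≤ 1 := fun x => by
    have := Real.sin_sq_le_one x
    nlinarith [sq_nonneg (Real.sin x)]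
  have hG : Integrable (Function.uncurry G) ((volume.restrict (Set.Ioc 0 1)).prod volume) := by
    have h1 : Integrable (fun p : ℝ × ℝ => (1 : ℝ) * spectralEnergy f p.2)
        ((volume.restrict (Set.Ioc (0 : ℝ) 1)).prod volume) :=
      (integrable_const (1 : ℝ)).mul_prod hE
    simp only [one_mul] at h1
    refine h1.mul_bdd (c := 16) (f := fun p : ℝ × ℝ => spectralEnergy f p.2)
      (g := fun p : ℝ × ℝ => 16 * Real.sin (Real.pi * (p.2 * (p.1 / ρ))) ^ 4)
      (by fun_prop) (ae_of_all _ fun p => ?_)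
    rw [Real.norm_of_nonneg (by positivity)]
    linarith [hsin (Real.pi * (p.2 * (p.1 / ρ)))]
  have low : ∀ r, S.indicator (fun r => 4 * spectralEnergy f r) r
      ≤ ∫ t in Set.Ioc (0 : ℝ) 1, G t r := by
    intro r
    have e : ∫ t in Set.Ioc (0 : ℝ) 1, G t r
        = spectralEnergy f r * (16 * ∫ t in (0 : ℝ)..1, Real.sin (Real.pi * (|r| / ρ) * t) ^ 4) := by
      rw [intervalIntegral.integral_of_le zero_le_one, ← integral_const_mul, ← integral_const_mul]
      congr 1
      ext t
      simp only [G]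
      congr 2
      rcases le_total 0 r with h | h
      · rw [abs_of_nonneg h]; congr 2; ring
      · rw [abs_of_nonpos h, show Real.pi * (-r / ρ) * t = -(Real.pi * (r * (t / ρ))) by ring,
          Real.sin_neg]; ring
    rw [e]
    by_cases hr : r ∈ S
    · rw [Set.indicator_of_mem hr]
      have := one_fourth_le_integral_sin_pow_four (x := |r| / ρ) ((one_le_div hρ).2 (le_of_lt hr))
      nlinarith [spectralEnergy_nonneg f r]
    · rw [Set.indicator_of_notMem hr]
      refine mul_nonneg (spectralEnergy_nonneg f r) (mul_nonneg (by norm_num) ?_)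
      exact intervalIntegral.integral_nonneg zero_le_one fun t _ => by positivity
  have up : ∀ t ∈ Set.Ioc (0 : ℝ) 1, ∫ r, G t r ≤ 264 / ρ * A ^ 2 := by
    intro t ht
    have h1 : t / ρ ≤ 1 / ρ := div_le_div_of_nonneg_right ht.2 hρ.le
    have h3 : 4 * (1 / ρ) ≤ b - a := by
      rw [mul_one_div, div_le_iff₀ hρ]; linarith
    have h2 : 0 < t / ρ := div_pos ht.1 hρ
    have h4 := hf.integral_secondDiff_sq_le h2 (by linarith)
    have h5 := hf.endSum_le h2.le h1 (by linarith)
    rw [← hf.integral_spectralEnergy_mul] at h4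
    refine h4.trans ?_
    have h6 : endSum f a b (t / ρ) ^ 2 ≤ (2 * A) ^ 2 :=
      pow_le_pow_left₀ (hf.endSum_nonneg _) h5 2
    calc 66 * (t / ρ) * endSum f a b (t / ρ) ^ 2 ≤ 66 * (1 / ρ) * (2 * A) ^ 2 := by gcongr
      _ = _ := by ring
  have main : ∫ r, S.indicator (fun r => 4 * spectralEnergy f r) r ≤ 264 / ρ * A ^ 2 := by
    calc _ ≤ ∫ r, ∫ t in Set.Ioc (0 : ℝ) 1, G t r :=
          integral_mono ((hE.const_mul 4).indicator hS) hG.integral_prod_right low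
      _ = ∫ t in Set.Ioc (0 : ℝ) 1, ∫ r, G t r := (integral_integral_swap hG).symm
      _ ≤ ∫ t in Set.Ioc (0 : ℝ) 1, 264 / ρ * A ^ 2 :=
          setIntegral_mono_on hG.integral_prod_left (integrableOn_const (by simp)) measurableSet_Ioc up
      _ = _ := by simp
  rw [integral_indicator hS, integral_const_mul] at main
  have : 264 / ρ * A ^ 2 = 4 * (66 / ρ * A ^ 2) := by ring
  linarith

/-- Lower bound for the dilation average of the Fourier transform of a concave profile. -/
theorem le_average : ∃ c K : ℝ, 0 < c ∧ 0 < K ∧ ∀ (f : ℝ → ℝ) (a b ρ : ℝ),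
    IsConcaveProfile f a b → 0 < ρ → K ≤ ρ * (b - a) →
    c * ρ⁻¹ ^ 2 * endSum f a b (1 / ρ) ^ 2
      ≤ ∫ δ in (0 : ℝ)..1, δ ^ 4 * spectralEnergy f (ρ * δ) := by
  -- A step `h = K/ρ` much longer than `1/ρ` makes the lower bound `h/32 · A²/4 = 1057 A²/ρ`,
  -- exceeding the contribution `16 · 66 A²/ρ = 1056 A²/ρ` of the frequencies above `ρ`. The excess
  -- `A²/ρ` must come from `|r| ≤ ρ`, where `sin⁴ x ≤ x⁴`. The threshold `4 * K` below ensures `4h ≤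
  -- b - a`.
  set K : ℝ := 128 * 1057 with hK
  refine ⟨1 / (32 * Real.pi ^ 4 * K ^ 4), 4 * K, by positivity, by positivity, ?_⟩
  intro f a b ρ hf hρ hh
  set A := endSum f a b (1 / ρ) with hA
  set h := K / ρ with hh'
  have h0 : 0 < h := by positivity
  have hle : 4 * h ≤ b - a := by
    rw [hh', ← mul_div_assoc, div_le_iff₀ hρ]; linarith
  have h1h : 1 / ρ ≤ h := by rw [hh']; gcongr; norm_num [hK]
  have hE := hf.integrable_spectralEnergy
  have hc := hf.continuous_spectralEnergy
  set S := {r : ℝ | ρ < |r|} with hSdef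
  have hS : MeasurableSet S := measurableSet_lt measurable_const (by fun_prop)
  have hSc : Sᶜ = Set.Icc (-ρ) ρ := by
    ext r; simp [hSdef, abs_le]
  have hsin : ∀ x : ℝ, Real.sin x ^ 4 ≤ 1 := fun x => by
    have := Real.sin_sq_le_one x
    nlinarith [sq_nonneg (Real.sin x)]
  have hi := hf.integrable_spectralEnergy_mul h
  have tail : ∫ r in S, spectralEnergy f r * (16 * Real.sin (Real.pi * (r * h)) ^ 4)
      ≤ 1056 / ρ * A ^ 2 := by
    calc _ ≤ ∫ r in S, 16 * spectralEnergy f r :=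
          integral_mono hi.integrableOn (hE.const_mul 16).integrableOn fun r => by
            have := spectralEnergy_nonneg f r
            have := hsin (Real.pi * (r * h))
            simp only
            nlinarith
      _ = 16 * ∫ r in S, spectralEnergy f r := integral_const_mul _ _
      _ ≤ 16 * (66 / ρ * A ^ 2) := by
          have := hf.tail_le hρ (by rw [hK] at hh; linarith)
          linarith
      _ = _ := by ring
  set J := ∫ r in (0 : ℝ)..ρ, r ^ 4 * spectralEnergy f r with hJ
  have hcont : Continuous fun r => r ^ 4 * spectralEnergy f r := by fun_prop
  have sym : ∫ r in Set.Icc (-ρ) ρ, r ^ 4 * spectralEnergy f r = 2 * J := by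
    rw [integral_Icc_eq_integral_Ioc, ← intervalIntegral.integral_of_le (by linarith),
      ← intervalIntegral.integral_add_adjacent_intervals (b := 0)
        (hcont.intervalIntegrable _ _) (hcont.intervalIntegrable _ _)]
    have : ∫ r in (-ρ)..0, r ^ 4 * spectralEnergy f r = J := by
      have := intervalIntegral.integral_comp_neg (a := 0) (b := ρ)
        (fun r => r ^ 4 * spectralEnergy f r)
      simp only [neg_zero, spectralEnergy_neg] at this
      rw [← this, hJ]
      congr 1
      ext r; ring
    rw [this]; ring
  have head : ∫ r in Sᶜ, spectralEnergy f r * (16 * Real.sin (Real.pi * (r * h)) ^ 4)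
      ≤ 16 * Real.pi ^ 4 * h ^ 4 * (2 * J) := by
    rw [← sym, hSc, ← integral_const_mul]
    refine setIntegral_mono_on hi.integrableOn (hcont.const_mul _).integrableOn_Icc
      measurableSet_Icc fun r _ => ?_
    have h1 : Real.sin (Real.pi * (r * h)) ^ 4 ≤ (Real.pi * (r * h)) ^ 4 := by
      have h2 : |Real.sin (Real.pi * (r * h))| ≤ |Real.pi * (r * h)| := Real.abs_sin_le_abs
      have := pow_le_pow_left₀ (abs_nonneg _) h2 4
      rwa [Even.pow_abs (by decide), Even.pow_abs (by decide)] at this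
    have := mul_le_mul_of_nonneg_left h1 (spectralEnergy_nonneg f r)
    nlinarith
  have total := integral_add_compl hS hi
  rw [hf.integral_spectralEnergy_mul h] at total
  have low := hf.le_integral_secondDiff_sq h0 hle
  have hAh : A ≤ 2 * endSum f a b h := hf.endSum_le (by positivity) h1h (by linarith)
  have hA2 : A ^ 2 / 4 ≤ endSum f a b h ^ 2 := by
    have := pow_le_pow_left₀ (hf.endSum_nonneg _) hAh 2
    linarith
  have fin : A ^ 2 / ρ ≤ 32 * Real.pi ^ 4 * K ^ 4 * (ρ⁻¹ ^ 4 * J) := by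
    have e1 : h / 32 * (A ^ 2 / 4) = 1057 * (A ^ 2 / ρ) := by
      rw [hh', hK]; ring
    have e2 := mul_le_mul_of_nonneg_left hA2 (show 0 ≤ h / 32 by positivity)
    have e3 : 16 * Real.pi ^ 4 * h ^ 4 * (2 * J) = 32 * Real.pi ^ 4 * K ^ 4 * (ρ⁻¹ ^ 4 * J) := by
      rw [hh']; ring
    have e4 : 1056 / ρ * A ^ 2 = 1056 * (A ^ 2 / ρ) := by ring
    rw [← e3]
    linarith
  rw [integral_pow_four_scale f hρ, ← hJ]
  have := mul_le_mul_of_nonneg_left fin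
    (show 0 ≤ 1 / (32 * Real.pi ^ 4 * K ^ 4) * ρ⁻¹ by positivity)
  calc _ = 1 / (32 * Real.pi ^ 4 * K ^ 4) * ρ⁻¹ * (A ^ 2 / ρ) := by ring
    _ ≤ _ := this
    _ = _ := by have := Real.pi_ne_zero; have : K ≠ 0 := by norm_num [hK]
                field_simp

end IsConcaveProfile

/-! ### Rotated coordinates, support lines and chords. -/

/-- The coordinate of `z` in the direction `u(θ)`. -/
def height (θ : ℝ) (z : Plane) : ℝ := z 0 * Real.cos θ + z 1 * Real.sin θ

/-- The coordinate of `z` in the direction `u'(θ)`. -/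
def tang (θ : ℝ) (z : Plane) : ℝ := -z 0 * Real.sin θ + z 1 * Real.cos θ

/-- The point with given coordinates in the frame `(u(θ), u'(θ))`. -/
def framePt (θ s t : ℝ) : Plane :=
  !₂[s * Real.cos θ - t * Real.sin θ, s * Real.sin θ + t * Real.cos θ]

@[simp] theorem framePt_zero (θ s t : ℝ) : framePt θ s t 0 = s * Real.cos θ - t * Real.sin θ := rfl
@[simp] theorem framePt_one (θ s t : ℝ) : framePt θ s t 1 = s * Real.sin θ + t * Real.cos θ := rfl

@[simp] theorem height_framePt (θ s t : ℝ) : height θ (framePt θ s t) = s := by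
  simp only [height, framePt_zero, framePt_one]
  linear_combination s * Real.sin_sq_add_cos_sq θ

@[simp] theorem tang_framePt (θ s t : ℝ) : tang θ (framePt θ s t) = t := by
  simp only [tang, framePt_zero, framePt_one]
  linear_combination t * Real.sin_sq_add_cos_sq θ

@[simp] theorem framePt_height_tang (θ : ℝ) (z : Plane) : framePt θ (height θ z) (tang θ z) = z := by
  ext i
  fin_cases i
  · simp only [Fin.zero_eta, framePt_zero, height, tang]
    linear_combination z 0 * Real.sin_sq_add_cos_sq θ
  · simp only [Fin.mk_one, framePt_one, height, tang]
    linear_combination z 1 * Real.sin_sq_add_cos_sq θ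

theorem norm_sq_eq_height_tang (θ : ℝ) (z : Plane) : ‖z‖ ^ 2 = height θ z ^ 2 + tang θ z ^ 2 := by
  rw [EuclideanSpace.norm_sq_eq, Fin.sum_univ_two, Real.norm_eq_abs, Real.norm_eq_abs, sq_abs,
    sq_abs]
  simp only [height, tang]
  linear_combination -(z 0 ^ 2 + z 1 ^ 2) * Real.sin_sq_add_cos_sq θ

theorem height_add (θ : ℝ) (x y : Plane) : height θ (x + y) = height θ x + height θ y := by
  simp only [height, PiLp.add_apply]; ring

theorem height_sub (θ : ℝ) (x y : Plane) : height θ (x - y) = height θ x - height θ y := by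
  simp only [height, PiLp.sub_apply]; ring

theorem height_smul (θ c : ℝ) (x : Plane) : height θ (c • x) = c * height θ x := by
  simp only [height, PiLp.smul_apply, smul_eq_mul]; ring

theorem tang_add (θ : ℝ) (x y : Plane) : tang θ (x + y) = tang θ x + tang θ y := by
  simp only [tang, PiLp.add_apply]; ring

theorem tang_sub (θ : ℝ) (x y : Plane) : tang θ (x - y) = tang θ x - tang θ y := by
  simp only [tang, PiLp.sub_apply]; ring

theorem tang_smul (θ c : ℝ) (x : Plane) : tang θ (c • x) = c * tang θ x := by
  simp only [tang, PiLp.smul_apply, smul_eq_mul]; ring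

theorem abs_height_le (θ : ℝ) (z : Plane) : |height θ z| ≤ ‖z‖ :=
  abs_le_of_sq_le_sq (by rw [norm_sq_eq_height_tang θ]; nlinarith [sq_nonneg (tang θ z)])
    (norm_nonneg z)

theorem abs_tang_le (θ : ℝ) (z : Plane) : |tang θ z| ≤ ‖z‖ :=
  abs_le_of_sq_le_sq (by rw [norm_sq_eq_height_tang θ]; nlinarith [sq_nonneg (height θ z)])
    (norm_nonneg z)

theorem abs_tang_sub_le (θ : ℝ) (x y : Plane) : |tang θ x - tang θ y| ≤ dist x y := by
  rw [← tang_sub, dist_eq_norm]; exact abs_tang_le θ _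

theorem height_add_pi (θ : ℝ) (z : Plane) : height (θ + Real.pi) z = -height θ z := by
  simp only [height, Real.cos_add_pi, Real.sin_add_pi]; ring

theorem framePt_add_pi (θ s t : ℝ) : framePt (θ + Real.pi) s t = framePt θ (-s) (-t) := by
  simp only [framePt, Real.cos_add_pi, Real.sin_add_pi]; congr 2 <;> ring_nf

theorem inner_unitVec (θ : ℝ) (z : Plane) : inner ℝ z (unitVec (θ : Real.Angle)) = height θ z := by
  simp [unitVec, height, PiLp.inner_apply, Fin.sum_univ_two, mul_comm]

theorem hasDerivAt_height (θ : ℝ) (z : Plane) :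
    HasDerivAt (fun θ => height θ z) (tang θ z) θ := by
  have := ((Real.hasDerivAt_cos θ).const_mul (z 0)).add ((Real.hasDerivAt_sin θ).const_mul (z 1))
  refine this.congr_deriv ?_
  simp only [tang]; ring

theorem abs_height_sub_height_le (θ θ' : ℝ) (z : Plane) :
    |height θ z - height θ' z| ≤ ‖z‖ * |θ - θ'| := by
  have := Convex.norm_image_sub_le_of_norm_hasDerivWithin_le (s := Set.univ)
    (f := fun θ => height θ z) (f' := fun θ => tang θ z) (C := ‖z‖) (x := θ') (y := θ)
    (fun x _ => (hasDerivAt_height x z).hasDerivWithinAt) (fun x _ => abs_tang_le x z)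
    convex_univ (Set.mem_univ _) (Set.mem_univ _)
  exact this

theorem continuous_height_uncurry : Continuous fun p : ℝ × Plane => height p.1 p.2 := by
  unfold height
  fun_prop

theorem continuous_tang_uncurry : Continuous fun p : ℝ × Plane => tang p.1 p.2 := by
  unfold tang
  fun_prop

theorem continuous_height (θ : ℝ) : Continuous (height θ) := by
  unfold height
  fun_prop

theorem continuous_tang (θ : ℝ) : Continuous (tang θ) := by
  unfold tang
  fun_prop

theorem continuous_framePt (θ : ℝ) : Continuous fun p : ℝ × ℝ => framePt θ p.1 p.2 := by
  unfold framePt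
  fun_prop

theorem framePt_combo (θ s t s' t' p q : ℝ) :
    p • framePt θ s t + q • framePt θ s' t' = framePt θ (p * s + q * s') (p * t + q * t') := by
  ext i
  fin_cases i <;> simp <;> ring

/-- A compact convex set in the plane with nonempty interior. -/
structure IsCompactBody (C : Set Plane) : Prop where
  convex : Convex ℝ C
  compact : IsCompact C
  interior_nonempty : (interior C).Nonempty

/-- The minimum of the height function in the direction `u(θ)`. -/
def lowest (C : Set Plane) (θ : ℝ) : ℝ := sInf (height θ '' C)

/-- The maximum of the height function in the direction `u(θ)`. -/
def highest (C : Set Plane) (θ : ℝ) : ℝ := sSup (height θ '' C)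

/-- The height of `z` over the support line of `C` in the direction `u(θ)`. -/
def gap (C : Set Plane) (θ : ℝ) (z : Plane) : ℝ := height θ z - lowest C θ

/-- The length of the chord of `C` at height `s` in the direction `u(θ)`. -/
def chord (C : Set Plane) (θ s : ℝ) : ℝ := volume.real {t | framePt θ s t ∈ C}

theorem chord_add_pi (C : Set Plane) (θ s : ℝ) : chord C (θ + Real.pi) s = chord C θ (-s) := by
  unfold chord
  have : {t | framePt (θ + Real.pi) s t ∈ C} = -{t | framePt θ (-s) t ∈ C} := by
    ext t; simp [framePt_add_pi]
  rw [this, measureReal_def, Measure.measure_neg, ← measureReal_def]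

namespace IsCompactBody

variable {C : Set Plane} (hC : IsCompactBody C)
include hC

theorem nonempty : C.Nonempty := hC.interior_nonempty.mono interior_subset

theorem compact_image (θ : ℝ) : IsCompact (height θ '' C) :=
  hC.compact.image (continuous_height θ)

theorem lowest_le (θ : ℝ) {z : Plane} (hz : z ∈ C) : lowest C θ ≤ height θ z :=
  csInf_le (hC.compact_image θ).bddBelow (Set.mem_image_of_mem _ hz)

theorem le_highest (θ : ℝ) {z : Plane} (hz : z ∈ C) : height θ z ≤ highest C θ :=
  le_csSup (hC.compact_image θ).bddAbove (Set.mem_image_of_mem _ hz)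

theorem exists_lowest (θ : ℝ) : ∃ z ∈ C, height θ z = lowest C θ :=
  (hC.compact_image θ).sInf_mem (hC.nonempty.image _)

theorem exists_highest (θ : ℝ) : ∃ z ∈ C, height θ z = highest C θ :=
  (hC.compact_image θ).sSup_mem (hC.nonempty.image _)

theorem gap_nonneg (θ : ℝ) {z : Plane} (hz : z ∈ C) : 0 ≤ gap C θ z :=
  sub_nonneg.2 (hC.lowest_le θ hz)

theorem lowest_add_pi (θ : ℝ) : lowest C (θ + Real.pi) = -highest C θ := by
  apply le_antisymm
  · obtain ⟨z, hz, h⟩ := hC.exists_highest θ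
    have := hC.lowest_le (θ + Real.pi) hz
    rwa [height_add_pi, h] at this
  · obtain ⟨z, hz, h⟩ := hC.exists_lowest (θ + Real.pi)
    rw [← h, height_add_pi]
    exact neg_le_neg (hC.le_highest θ hz)

theorem isCompact_slice (θ s : ℝ) : IsCompact {t | framePt θ s t ∈ C} := by
  have hcl : IsClosed {t | framePt θ s t ∈ C} :=
    hC.compact.isClosed.preimage ((continuous_framePt θ).comp (Continuous.prodMk_right s))
  refine (hC.compact.image (continuous_tang θ)).of_isClosed_subset hcl ?_
  intro t ht
  exact ⟨_, ht, tang_framePt θ s t⟩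

theorem convex_slice (θ s : ℝ) : Convex ℝ {t | framePt θ s t ∈ C} := by
  intro t ht t' ht' p q hp hq hpq
  have := hC.convex ht ht' hp hq hpq
  rw [framePt_combo, ← add_mul, hpq, one_mul] at this
  exact this

theorem slice_nonempty {θ s : ℝ} (hs : s ∈ Set.Icc (lowest C θ) (highest C θ)) :
    {t | framePt θ s t ∈ C}.Nonempty := by
  obtain ⟨x, hx, hx'⟩ := hC.exists_lowest θ
  obtain ⟨y, hy, hy'⟩ := hC.exists_highest θ
  have := hC.convex.isPreconnected.image (height θ) (continuous_height θ).continuousOn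
  have h2 := this.ordConnected.out (Set.mem_image_of_mem _ hx) (Set.mem_image_of_mem _ hy)
  rw [hx', hy'] at h2
  obtain ⟨z, hz, rfl⟩ := h2 hs
  exact ⟨tang θ z, by simpa using hz⟩

theorem slice_eq_Icc {θ s : ℝ} (hs : s ∈ Set.Icc (lowest C θ) (highest C θ)) :
    {t | framePt θ s t ∈ C}
      = Set.Icc (sInf {t | framePt θ s t ∈ C}) (sSup {t | framePt θ s t ∈ C}) :=
  eq_Icc_of_connected_compact ⟨hC.slice_nonempty hs, (hC.convex_slice θ s).isPreconnected⟩
    (hC.isCompact_slice θ s)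

theorem chord_eq {θ s : ℝ} (hs : s ∈ Set.Icc (lowest C θ) (highest C θ)) :
    chord C θ s = sSup {t | framePt θ s t ∈ C} - sInf {t | framePt θ s t ∈ C} := by
  have hle : sInf {t | framePt θ s t ∈ C} ≤ sSup {t | framePt θ s t ∈ C} :=
    Real.sInf_le_sSup _ (hC.isCompact_slice θ s).bddBelow (hC.isCompact_slice θ s).bddAbove
  unfold chord
  conv_lhs => rw [hC.slice_eq_Icc hs]
  rw [Real.volume_real_Icc, max_eq_left (by linarith)]

theorem chord_eq_zero {θ s : ℝ} (hs : s ∉ Set.Icc (lowest C θ) (highest C θ)) :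
    chord C θ s = 0 := by
  have : {t | framePt θ s t ∈ C} = ∅ := by
    ext t
    simp only [Set.mem_ofPred_eq, Set.mem_empty_iff_false, iff_false]
    intro h
    have h1 := hC.lowest_le θ h
    have h2 := hC.le_highest θ h
    rw [height_framePt] at h1 h2
    exact hs ⟨h1, h2⟩
  unfold chord
  rw [this, measureReal_empty]

theorem exists_ball : ∃ c : Plane, ∃ r : ℝ, 0 < r ∧ Metric.closedBall c r ⊆ C := by
  obtain ⟨c, hc⟩ := hC.interior_nonempty
  obtain ⟨r, hr, h⟩ := Metric.isOpen_iff.1 isOpen_interior c hc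
  exact ⟨c, r / 2, by linarith, (Metric.closedBall_subset_ball (by linarith)).trans
    (h.trans interior_subset)⟩

theorem lowest_add_le {c : Plane} {r : ℝ} (hr : 0 < r) (hcr : Metric.closedBall c r ⊆ C) (θ : ℝ) :
    lowest C θ + r ≤ height θ c := by
  have hm : c - framePt θ r 0 ∈ C := by
    apply hcr
    rw [Metric.mem_closedBall, dist_eq_norm, sub_sub_cancel_left, norm_neg]
    apply le_of_sq_le_sq _ hr.le
    rw [norm_sq_eq_height_tang θ, height_framePt, tang_framePt]; simp
  have := hC.lowest_le θ hm
  rw [height_sub, height_framePt] at this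
  linarith

theorem two_mul_le_width {c : Plane} {r : ℝ} (hr : 0 < r) (hcr : Metric.closedBall c r ⊆ C)
    (θ : ℝ) : 2 * r ≤ highest C θ - lowest C θ := by
  have h1 := hC.lowest_add_le hr hcr θ
  have h2 := hC.lowest_add_le hr hcr (θ + Real.pi)
  rw [hC.lowest_add_pi, height_add_pi] at h2
  linarith

/-- Convex combinations of the upper (lower) endpoints of two slices belong to the intermediate
slice. -/
theorem chord_isConcaveProfile (θ : ℝ) :
    IsConcaveProfile (chord C θ) (lowest C θ) (highest C θ) where
  lt := by
    obtain ⟨c, r, hr, hcr⟩ := hC.exists_ball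
    linarith [hC.two_mul_le_width hr hcr θ]
  nonneg s := measureReal_nonneg
  eq_zero s hs := hC.chord_eq_zero hs
  concave := by
    refine ⟨convex_Icc _ _, fun x hx y hy p q hp hq hpq => ?_⟩
    have hm := (convex_Icc (lowest C θ) (highest C θ)) hx hy hp hq hpq
    rw [hC.chord_eq hx, hC.chord_eq hy, hC.chord_eq hm]
    have key : ∀ t t', framePt θ x t ∈ C → framePt θ y t' ∈ C →
        p * t + q * t' ∈ {t | framePt θ (p • x + q • y) t ∈ C} := by
      intro t t' h h'
      have := hC.convex h h' hp hq hpq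
      rwa [framePt_combo] at this
    have h1 := le_csSup (hC.isCompact_slice θ _).bddAbove
      (key _ _ ((hC.isCompact_slice θ x).sSup_mem (hC.slice_nonempty hx))
        ((hC.isCompact_slice θ y).sSup_mem (hC.slice_nonempty hy)))
    have h2 := csInf_le (hC.isCompact_slice θ _).bddBelow
      (key _ _ ((hC.isCompact_slice θ x).sInf_mem (hC.slice_nonempty hx))
        ((hC.isCompact_slice θ y).sInf_mem (hC.slice_nonempty hy)))
    simp only [smul_eq_mul] at h1 h2 ⊢
    linarith

/-- The upper end in direction `θ` is the lower end in direction `θ + π`, so only chords above the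
lowest support line need study. -/
theorem endSum_chord (θ h : ℝ) :
    endSum (chord C θ) (lowest C θ) (highest C θ) h
      = chord C θ (lowest C θ + h) + chord C (θ + Real.pi) (lowest C (θ + Real.pi) + h) := by
  rw [hC.lowest_add_pi, chord_add_pi]
  unfold endSum
  congr 2; ring

end IsCompactBody

/-! ### From the planar Fourier transform to the transform of the chord function. -/

/-- The rotation of the plane which maps the standard frame to the frame `(u(θ), u'(θ))`. -/
def frameIsometry (θ : ℝ) : Plane →ₗᵢ[ℝ] Plane where
  toFun z := framePt θ (z 0) (z 1)
  map_add' x y := by ext i; fin_cases i <;> simp <;> ring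
  map_smul' c x := by ext i; fin_cases i <;> simp <;> ring
  norm_map' z := by
    have h : ‖framePt θ (z 0) (z 1)‖ ^ 2 = ‖z‖ ^ 2 := by
      rw [norm_sq_eq_height_tang θ, height_framePt, tang_framePt, EuclideanSpace.norm_sq_eq,
        Fin.sum_univ_two, Real.norm_eq_abs, Real.norm_eq_abs, sq_abs, sq_abs]
    exact (pow_left_inj₀ (norm_nonneg _) (norm_nonneg _) two_ne_zero).1 h

theorem measurePreserving_framePt (θ : ℝ) :
    MeasurePreserving (fun p : ℝ × ℝ => framePt θ p.1 p.2) := by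
  have h1 : MeasurePreserving (frameIsometry θ : Plane → Plane) :=
    ((frameIsometry θ).toLinearIsometryEquiv rfl).measurePreserving
  have h2 := PiLp.volume_preserving_toLp (Fin 2)
  have h3 := (volume_preserving_finTwoArrow ℝ).symm
  exact (h1.comp h2).comp h3

theorem measurableEmbedding_framePt (θ : ℝ) :
    MeasurableEmbedding (fun p : ℝ × ℝ => framePt θ p.1 p.2) := by
  refine (continuous_framePt θ).measurableEmbedding fun p q h => ?_
  have h1 := congrArg (height θ) h
  have h2 := congrArg (tang θ) h
  simp only [height_framePt, tang_framePt] at h1 h2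
  exact Prod.ext h1 h2

theorem charFourier_eq_integral (Ω : Set Plane) (hΩ : MeasurableSet Ω) (ξ : Plane) :
    charFourier Ω ξ = ∫ z in Ω, ((Real.fourierChar (-inner ℝ z ξ) : Circle) : ℂ) := by
  unfold charFourier
  rw [Real.fourier_eq, ← integral_indicator hΩ]
  congr 1
  ext z
  by_cases h : z ∈ Ω
  · simp [h, Circle.smul_def]
  · simp [h]

theorem charFourier_congr_ae {Ω Ω' : Set Plane} (h : Ω =ᵐ[volume] Ω') (ξ : Plane) :
    charFourier Ω ξ = charFourier Ω' ξ := by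
  unfold charFourier
  rw [Real.fourier_eq, Real.fourier_eq]
  apply integral_congr_ae
  filter_upwards [indicator_ae_eq_of_ae_eq_set (f := fun _ : Plane => (1 : ℂ)) h] with x hx
  rw [hx]

theorem charFourier_smul {Ω : Set Plane} {δ : ℝ} (hδ : 0 < δ)
    (ξ : Plane) : charFourier (δ • Ω) ξ = (δ : ℂ) ^ 2 * charFourier Ω (δ • ξ) := by
  unfold charFourier
  rw [Real.fourier_eq, Real.fourier_eq]
  have h := Measure.integral_comp_smul (μ := (volume : Measure Plane))
    (fun v => Real.fourierChar (-inner ℝ v ξ) • (δ • Ω).indicator (fun _ => (1 : ℂ)) v) δ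
  have e : (fun v : Plane => Real.fourierChar (-inner ℝ (δ • v) ξ)
      • (δ • Ω).indicator (fun _ => (1 : ℂ)) (δ • v))
      = fun v => Real.fourierChar (-inner ℝ v (δ • ξ)) • Ω.indicator (fun _ => (1 : ℂ)) v := by
    ext v
    rw [inner_smul_left, inner_smul_right]
    congr 1
    have hiff : δ • v ∈ δ • Ω ↔ v ∈ Ω := Set.smul_mem_smul_set_iff₀ hδ.ne' Ω v
    by_cases hv : v ∈ Ω
    · rw [Set.indicator_of_mem hv, Set.indicator_of_mem (hiff.2 hv)]
    · rw [Set.indicator_of_notMem hv, Set.indicator_of_notMem (fun h => hv (hiff.1 h))]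
  rw [e] at h
  rw [h, finrank_euclideanSpace_fin, abs_of_pos (by positivity), Complex.real_smul, ← mul_assoc]
  have : (δ : ℂ) ≠ 0 := by exact_mod_cast hδ.ne'
  push_cast
  rw [mul_inv_cancel₀ (pow_ne_zero 2 this), one_mul]

theorem continuous_charFourier {Ω : Set Plane} (hΩ : IsCompact Ω) :
    Continuous (charFourier Ω) := by
  have hi : Integrable (Ω.indicator (fun _ => (1 : ℂ))) :=
    (integrable_indicator_iff hΩ.measurableSet).2 (integrableOn_const hΩ.measure_lt_top.ne)
  exact VectorFourier.fourierIntegral_continuous Real.continuous_fourierChar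
    (by exact continuous_inner) hi

theorem continuous_unitVec : Continuous fun θ : ℝ => unitVec (θ : Real.Angle) := by
  unfold unitVec
  simp only [Real.Angle.cos_coe, Real.Angle.sin_coe]
  fun_prop

/-- The mean over dilations of the square modulus of the Fourier transform, in terms of chords. -/
def dilationAverage (C : Set Plane) (ρ θ : ℝ) : ℝ :=
  ∫ δ in (0 : ℝ)..1, δ ^ 4 * spectralEnergy (chord C θ) (ρ * δ)

namespace IsCompactBody

variable {C : Set Plane} (hC : IsCompactBody C)
include hC

/-- The Fourier slice theorem: in the rotated frame the exponential depends on the height only, so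
the inner integral in Fubini is a chord length. -/
theorem charFourier_eq_fourier_chord (θ r : ℝ) :
    charFourier C (r • unitVec (θ : Real.Angle)) = 𝓕 (fun s => (chord C θ s : ℂ)) r := by
  have hm := hC.compact.measurableSet
  have hmT := (measurableEmbedding_framePt θ).measurable hm
  set T : Set (ℝ × ℝ) := (fun p : ℝ × ℝ => framePt θ p.1 p.2) ⁻¹' C with hT
  have hTfin : volume T ≠ ∞ := by
    rw [hT, (measurePreserving_framePt θ).measure_preimage hm.nullMeasurableSet]
    exact hC.compact.measure_lt_top.ne
  rw [charFourier_eq_integral C hm,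
    ← (measurePreserving_framePt θ).setIntegral_preimage_emb (measurableEmbedding_framePt θ),
    ← hT, ← integral_indicator hmT]
  have e : ∀ p : ℝ × ℝ, T.indicator (fun p : ℝ × ℝ => ((Real.fourierChar
      (-inner ℝ (framePt θ p.1 p.2) (r • unitVec (θ : Real.Angle))) : Circle) : ℂ)) p
      = ((Real.fourierChar (-(p.1 * r)) : Circle) : ℂ) * T.indicator (fun _ => (1 : ℂ)) p := by
    intro p
    by_cases h : p ∈ T
    · rw [Set.indicator_of_mem h, Set.indicator_of_mem h, inner_smul_right, inner_unitVec,
        height_framePt, mul_comm r, mul_one]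
    · rw [Set.indicator_of_notMem h, Set.indicator_of_notMem h, mul_zero]
  simp only [e]
  have hi : Integrable fun p : ℝ × ℝ =>
      ((Real.fourierChar (-(p.1 * r)) : Circle) : ℂ) * T.indicator (fun _ => (1 : ℂ)) p := by
    have h1 : Integrable (T.indicator (fun _ => (1 : ℂ))) :=
      (integrable_indicator_iff hmT).2 (integrableOn_const hTfin)
    refine h1.bdd_mul (c := 1) ?_ (ae_of_all _ fun p => (Circle.norm_coe _).le)
    refine Continuous.aestronglyMeasurable ?_
    exact continuous_subtype_val.comp (Real.continuous_fourierChar.comp (by fun_prop))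
  rw [Measure.volume_eq_prod, integral_prod _ hi, Real.fourier_real_eq]
  congr 1
  ext s
  rw [Circle.smul_def, smul_eq_mul]
  refine (integral_const_mul ((Real.fourierChar (-(s * r)) : Circle) : ℂ)
    fun t => T.indicator (fun _ => (1 : ℂ)) (s, t)).trans ?_
  congr 1
  have : (fun t => T.indicator (fun _ => (1 : ℂ)) (s, t))
      = {t | framePt θ s t ∈ C}.indicator (fun _ => (1 : ℂ)) := by
    rfl
  rw [this, integral_indicator (hC.isCompact_slice θ s).measurableSet, setIntegral_const]
  simp [chord]

theorem integral_charFourier_smul (θ ρ : ℝ) :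
    ∫ δ in (0 : ℝ)..1, ‖charFourier (δ • C) (ρ • unitVec (θ : Real.Angle))‖ ^ 2
      = dilationAverage C ρ θ := by
  unfold dilationAverage
  rw [intervalIntegral.integral_of_le zero_le_one, intervalIntegral.integral_of_le zero_le_one]
  refine setIntegral_congr_fun measurableSet_Ioc fun δ hδ => ?_
  rw [charFourier_smul hδ.1, smul_smul, mul_comm δ ρ, hC.charFourier_eq_fourier_chord]
  unfold spectralEnergy
  rw [norm_mul, norm_pow, Complex.norm_real, Real.norm_of_nonneg hδ.1.le]
  ring

theorem continuous_dilationAverage (ρ : ℝ) : Continuous (dilationAverage C ρ) := by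
  have h := continuous_charFourier hC.compact
  have hu := continuous_unitVec
  have e : ∀ θ r, spectralEnergy (chord C θ) r
      = ‖charFourier C (r • unitVec (θ : Real.Angle))‖ ^ 2 := fun θ r => by
    rw [hC.charFourier_eq_fourier_chord]; rfl
  unfold dilationAverage
  simp only [e]
  apply intervalIntegral.continuous_parametric_intervalIntegral_of_continuous'
  have : Continuous fun p : ℝ × ℝ => charFourier C ((ρ * p.2) • unitVec (p.1 : Real.Angle)) :=
    h.comp ((continuous_const.mul continuous_snd).smul (hu.comp continuous_fst))
  exact (continuous_snd.pow 4).mul (this.norm.pow 2)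

theorem fourierAverage_eq (α β ρ : ℝ) :
    fourierAverage C α β ρ = ∫ θ in α..β, dilationAverage C ρ θ := by
  exact intervalIntegral.integral_congr fun θ _ => hC.integral_charFourier_smul θ ρ

end IsCompactBody

/-! ### Length of the boundary of a convex set. -/

theorem inter_frontier_nonempty_of_isPreconnected {X : Type*} [TopologicalSpace X] {S t : Set X}
    (hS : IsPreconnected S) (h1 : (S ∩ t).Nonempty) (h2 : (S ∩ tᶜ).Nonempty) :
    (S ∩ frontier t).Nonempty := by
  by_contra hne
  rw [Set.not_nonempty_iff_eq_empty] at hne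
  have hcase : ∀ x ∈ S, x ∈ interior t ∨ x ∈ (closure t)ᶜ := by
    intro x hx
    by_contra hcon
    rw [not_or, Set.notMem_compl_iff] at hcon
    exact Set.notMem_empty x (hne ▸ ⟨hx, hcon.2, hcon.1⟩)
  obtain ⟨x, hx, hxt⟩ := h1
  obtain ⟨y, hy, hyt⟩ := h2
  obtain ⟨z, _, hz1, hz2⟩ := hS (interior t) (closure t)ᶜ isOpen_interior isClosed_closure.isOpen_compl
    hcase ⟨x, hx, (hcase x hx).resolve_right fun h => h (subset_closure hxt)⟩
    ⟨y, hy, (hcase y hy).resolve_left fun h => hyt (interior_subset h)⟩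
  exact hz2 (interior_subset_closure hz1)

section NearestPoint

variable {E : Type*} [NormedAddCommGroup E] [InnerProductSpace ℝ E]

theorem exists_nearest_point_map [CompleteSpace E] {K : Set E} (hne : K.Nonempty)
    (hcl : IsClosed K) (hconv : Convex ℝ K) :
    ∃ p : E → E, (∀ x, p x ∈ K) ∧ ∀ x, ∀ w ∈ K, inner ℝ (x - p x) (w - p x) ≤ 0 := by
  have h := fun x => exists_norm_eq_iInf_of_complete_convex hne hcl.isComplete hconv x
  choose p hp hp' using h
  exact ⟨p, hp, fun x => (norm_eq_iInf_iff_real_inner_le_zero hconv (hp x)).1 (hp' x)⟩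

theorem nearest_point_unique {K : Set E} {x y z : E} (hy : y ∈ K) (hz : z ∈ K)
    (h1 : ∀ w ∈ K, inner ℝ (x - y) (w - y) ≤ 0) (h2 : ∀ w ∈ K, inner ℝ (x - z) (w - z) ≤ 0) :
    y = z := by
  have a := h1 z hz
  have b := h2 y hy
  have : inner ℝ (y - z) (y - z) ≤ 0 := by
    have e : inner ℝ (y - z) (y - z) = inner ℝ (x - y) (z - y) + inner ℝ (x - z) (y - z) := by
      simp only [inner_sub_left, inner_sub_right]
      ring
    rw [e]; linarith
  exact sub_eq_zero.1 (inner_self_eq_zero.1 (le_antisymm this real_inner_self_nonneg))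

theorem nearest_point_lipschitz {K : Set E} {p : E → E} (hp : ∀ x, p x ∈ K)
    (h : ∀ x, ∀ w ∈ K, inner ℝ (x - p x) (w - p x) ≤ 0) : LipschitzWith 1 p := by
  refine LipschitzWith.of_dist_le_mul fun x y => ?_
  rw [NNReal.coe_one, one_mul, dist_eq_norm, dist_eq_norm]
  have a := h x (p y) (hp y)
  have b := h y (p x) (hp x)
  have e : inner ℝ (x - y) (p x - p y) - inner ℝ (p x - p y) (p x - p y)
      = -(inner ℝ (x - p x) (p y - p x) + inner ℝ (y - p y) (p x - p y)) := by
    simp only [inner_sub_left, inner_sub_right]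
    ring
  rw [real_inner_self_eq_norm_sq] at e
  have c := real_inner_le_norm (x - y) (p x - p y)
  by_contra hlt
  push Not at hlt
  nlinarith [norm_nonneg (x - y), norm_nonneg (p x - p y)]

/-- The boundary of a convex set has at most the length of the boundary of a surrounding set. -/
theorem hausdorffMeasure_frontier_le [CompleteSpace E] [MeasurableSpace E] [BorelSpace E]
    {K B : Set E} (hne : K.Nonempty) (hcl : IsClosed K) (hconv : Convex ℝ K) (hB : IsCompact B)
    (hKB : K ⊆ B) : (μH[1] : Measure E) (frontier K) ≤ (μH[1] : Measure E) (frontier B) := by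
  obtain ⟨p, hp, hvar⟩ := exists_nearest_point_map hne hcl hconv
  have hlip := nearest_point_lipschitz hp hvar
  have hfB : IsCompact (frontier B) :=
    hB.of_isClosed_subset isClosed_frontier hB.isClosed.frontier_subset
  have himg : IsClosed (p '' frontier B) := (hfB.image hlip.continuous).isClosed
  have hout : ∀ x, x ∉ K → p x ∈ p '' frontier B := by
    intro x hx
    -- The ray from `p x` through `x` starts in `B` and is unbounded, so it meets `frontier B`. All
    -- its points have the same nearest point `p x` in `K`.
    set n := x - p x with hn
    have hn0 : n ≠ 0 := fun h => hx (by
      rw [sub_eq_zero.1 (hn.symm.trans h)]; exact hp x)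
    set R : ℝ → E := fun s => p x + s • n with hR
    have hRc : Continuous R := by fun_prop
    have hpre : IsPreconnected (R '' Set.Ici 0) := isPreconnected_Ici.image R hRc.continuousOn
    have h1 : (R '' Set.Ici 0 ∩ B).Nonempty :=
      ⟨p x, ⟨0, by simp, by simp [hR]⟩, hKB (hp x)⟩
    have h2 : (R '' Set.Ici 0 ∩ Bᶜ).Nonempty := by
      obtain ⟨M, hM⟩ := hB.isBounded.exists_norm_le
      have hnpos : 0 < ‖n‖ := norm_pos_iff.2 hn0
      set s := (|M| + 1 + ‖p x‖) / ‖n‖ with hs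
      have hs0 : 0 ≤ s := by positivity
      refine ⟨R s, ⟨s, hs0, rfl⟩, fun hmem => ?_⟩
      have h3 := hM _ hmem
      have h4 : ‖s • n‖ ≤ ‖R s‖ + ‖p x‖ := by
        have : s • n = R s - p x := by simp [hR]
        rw [this]; exact norm_sub_le _ _
      rw [norm_smul, Real.norm_of_nonneg hs0, hs, div_mul_cancel₀ _ hnpos.ne'] at h4
      linarith [le_abs_self M]
    obtain ⟨y, ⟨s, hs, hsy⟩, hy⟩ := inter_frontier_nonempty_of_isPreconnected hpre h1 h2
    refine ⟨y, hy, ?_⟩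
    refine nearest_point_unique (hp y) (hp x) (hvar y) fun w hw => ?_
    have : y - p x = s • n := by rw [← hsy]; simp [hR]
    rw [this, inner_smul_left]
    exact mul_nonpos_of_nonneg_of_nonpos (by simpa using hs) (hvar x w hw)
  -- A boundary point of `K` is fixed by `p` and is a limit of points outside `K`, whose projections
  -- lie in the closed set `p '' frontier B`.
  have hsub : frontier K ⊆ p '' frontier B := by
    intro z hz
    have hzK : z ∈ K := hcl.frontier_subset hz
    have hpz : p z = z := nearest_point_unique (hp z) hzK (hvar z) fun w _ => by simp
    have hcl2 : z ∈ closure Kᶜ := by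
      rw [frontier_eq_closure_inter_closure] at hz; exact hz.2
    have : p z ∈ closure (p '' Kᶜ) := image_closure_subset_closure_image hlip.continuous
      (Set.mem_image_of_mem p hcl2)
    rw [hpz] at this
    refine closure_minimal ?_ himg this
    rintro _ ⟨x, hx, rfl⟩
    exact hout x hx
  calc _ ≤ (μH[1] : Measure E) (p '' frontier B) := measure_mono hsub
    _ ≤ _ := by simpa using hlip.hausdorffMeasure_image_le zero_le_one (frontier B)

end NearestPoint

/-- The rectangle `[s₁, s₂] × [t₁, t₂]` in the frame `(u(θ), u'(θ))`. -/
def frameBox (θ s₁ s₂ t₁ t₂ : ℝ) : Set Plane :=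
  {z | height θ z ∈ Set.Icc s₁ s₂ ∧ tang θ z ∈ Set.Icc t₁ t₂}

theorem dist_framePt (θ s t s' t' : ℝ) :
    dist (framePt θ s t) (framePt θ s' t') ^ 2 = (s - s') ^ 2 + (t - t') ^ 2 := by
  rw [dist_eq_norm, norm_sq_eq_height_tang θ, height_sub, tang_sub]
  simp

theorem isCompact_frameBox (θ s₁ s₂ t₁ t₂ : ℝ) : IsCompact (frameBox θ s₁ s₂ t₁ t₂) := by
  have : frameBox θ s₁ s₂ t₁ t₂
      = (fun p : ℝ × ℝ => framePt θ p.1 p.2) '' (Set.Icc s₁ s₂ ×ˢ Set.Icc t₁ t₂) := by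
    ext z
    constructor
    · rintro ⟨h1, h2⟩
      exact ⟨(height θ z, tang θ z), ⟨h1, h2⟩, framePt_height_tang θ z⟩
    · rintro ⟨⟨s, t⟩, ⟨h1, h2⟩, rfl⟩
      exact ⟨by simpa using h1, by simpa using h2⟩
  rw [this]
  exact (isCompact_Icc.prod isCompact_Icc).image (continuous_framePt θ)

theorem hausdorffMeasure_horizontal_le (θ s t₁ t₂ : ℝ) :
    (μH[1] : Measure Plane) ((fun t => framePt θ s t) '' Set.Icc t₁ t₂)
      ≤ ENNReal.ofReal (t₂ - t₁) := by
  have hl : LipschitzWith 1 (fun t => framePt θ s t) := LipschitzWith.of_dist_le_mul fun t t' => by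
    rw [NNReal.coe_one, one_mul]
    refine le_of_sq_le_sq ?_ dist_nonneg
    rw [dist_framePt, Real.dist_eq, sq_abs]; simp
  have := hl.hausdorffMeasure_image_le zero_le_one (Set.Icc t₁ t₂)
  simpa [hausdorffMeasure_real] using this

theorem hausdorffMeasure_vertical_le (θ s₁ s₂ t : ℝ) :
    (μH[1] : Measure Plane) ((fun s => framePt θ s t) '' Set.Icc s₁ s₂)
      ≤ ENNReal.ofReal (s₂ - s₁) := by
  have hl : LipschitzWith 1 (fun s => framePt θ s t) := LipschitzWith.of_dist_le_mul fun s s' => by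
    rw [NNReal.coe_one, one_mul]
    refine le_of_sq_le_sq ?_ dist_nonneg
    rw [dist_framePt, Real.dist_eq, sq_abs]; simp
  have := hl.hausdorffMeasure_image_le zero_le_one (Set.Icc s₁ s₂)
  simpa [hausdorffMeasure_real] using this

theorem hausdorffMeasure_frontier_frameBox_le (θ : ℝ) {s₁ s₂ t₁ t₂ : ℝ} (hs : s₁ ≤ s₂)
    (ht : t₁ ≤ t₂) : (μH[1] : Measure Plane) (frontier (frameBox θ s₁ s₂ t₁ t₂))
      ≤ ENNReal.ofReal (2 * (s₂ - s₁) + 2 * (t₂ - t₁)) := by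
  set B := frameBox θ s₁ s₂ t₁ t₂ with hB
  have hcl : IsClosed B := (isCompact_frameBox θ s₁ s₂ t₁ t₂).isClosed
  have hopen : IsOpen {z : Plane | height θ z ∈ Set.Ioo s₁ s₂ ∧ tang θ z ∈ Set.Ioo t₁ t₂} :=
    (isOpen_Ioo.preimage (continuous_height θ)).inter (isOpen_Ioo.preimage (continuous_tang θ))
  have hint : {z : Plane | height θ z ∈ Set.Ioo s₁ s₂ ∧ tang θ z ∈ Set.Ioo t₁ t₂} ⊆ interior B :=
    interior_maximal (fun z hz => ⟨Set.Ioo_subset_Icc_self hz.1, Set.Ioo_subset_Icc_self hz.2⟩) hopen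
  have hsub : frontier B ⊆ (((fun t => framePt θ s₁ t) '' Set.Icc t₁ t₂)
      ∪ ((fun t => framePt θ s₂ t) '' Set.Icc t₁ t₂))
      ∪ (((fun s => framePt θ s t₁) '' Set.Icc s₁ s₂)
      ∪ ((fun s => framePt θ s t₂) '' Set.Icc s₁ s₂)) := by
    intro z hz
    have hzB : z ∈ B := hcl.frontier_subset hz
    have hni : ¬(height θ z ∈ Set.Ioo s₁ s₂ ∧ tang θ z ∈ Set.Ioo t₁ t₂) := fun h => hz.2 (hint h)
    obtain ⟨⟨a1, a2⟩, ⟨b1, b2⟩⟩ := hzB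
    have hz' := framePt_height_tang θ z
    rcases eq_or_lt_of_le a1 with h | h
    · exact Or.inl (Or.inl ⟨tang θ z, ⟨b1, b2⟩, by simp only [h, hz']⟩)
    rcases eq_or_lt_of_le a2 with h' | h'
    · exact Or.inl (Or.inr ⟨tang θ z, ⟨b1, b2⟩, by simp only [← h', hz']⟩)
    rcases eq_or_lt_of_le b1 with k | k
    · exact Or.inr (Or.inl ⟨height θ z, ⟨a1, a2⟩, by simp only [k, hz']⟩)
    rcases eq_or_lt_of_le b2 with k' | k'
    · exact Or.inr (Or.inr ⟨height θ z, ⟨a1, a2⟩, by simp only [← k', hz']⟩)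
    exact absurd ⟨⟨h, h'⟩, ⟨k, k'⟩⟩ hni
  refine (measure_mono hsub).trans ?_
  refine (measure_union_le _ _).trans ?_
  refine (add_le_add (measure_union_le _ _) (measure_union_le _ _)).trans ?_
  refine (add_le_add (add_le_add (hausdorffMeasure_horizontal_le _ _ _ _)
    (hausdorffMeasure_horizontal_le _ _ _ _)) (add_le_add (hausdorffMeasure_vertical_le _ _ _ _)
    (hausdorffMeasure_vertical_le _ _ _ _))).trans ?_
  rw [← ENNReal.ofReal_add (by linarith) (by linarith),
    ← ENNReal.ofReal_add (by linarith) (by linarith),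
    ← ENNReal.ofReal_add (by linarith) (by linarith)]
  exact ENNReal.ofReal_le_ofReal (by linarith)

/-! ### Squared chords against the integral of the slope along the boundary. -/

/-- The absolute value of the derivative in `θ` of the gap of `z`, cut off where the gap is not
less than `δ`. -/
def slopeMass (C : Set Plane) (δ θ : ℝ) (z : Plane) : ℝ :=
  {w | gap C θ w < δ}.indicator (fun w => |tang θ w - deriv (lowest C) θ|) z

/-- The arc length measure on the boundary. -/
def bdryMeasure (C : Set Plane) : Measure Plane := (μH[1] : Measure Plane).restrict (frontier C)

theorem slopeMass_nonneg (C : Set Plane) (δ θ : ℝ) (z : Plane) : 0 ≤ slopeMass C δ θ z :=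
  Set.indicator_nonneg (fun _ _ => abs_nonneg _) _

theorem lipschitzWith_tang (θ : ℝ) : LipschitzWith 1 (tang θ) :=
  LipschitzWith.of_dist_le_mul fun x y => by
    rw [NNReal.coe_one, one_mul, Real.dist_eq]; exact abs_tang_sub_le θ x y

theorem ae_mem_frontier (C : Set Plane) : ∀ᵐ z ∂(bdryMeasure C), z ∈ frontier C :=
  ae_restrict_mem isClosed_frontier.measurableSet

theorem hasDerivAt_gap {C : Set Plane} {θ : ℝ} (hd : DifferentiableAt ℝ (lowest C) θ) (z : Plane) :
    HasDerivAt (fun θ => gap C θ z) (tang θ z - deriv (lowest C) θ) θ :=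
  (hasDerivAt_height θ z).sub hd.hasDerivAt

namespace IsCompactBody

variable {C : Set Plane} (hC : IsCompactBody C)
include hC

theorem exists_norm_bound : ∃ R : ℝ, 0 < R ∧ ∀ z ∈ C, ‖z‖ ≤ R := by
  obtain ⟨M, hM⟩ := hC.compact.isBounded.exists_norm_le
  exact ⟨|M| + 1, by positivity, fun z hz => (hM z hz).trans (by linarith [le_abs_self M])⟩

theorem frontier_subset : frontier C ⊆ C := hC.compact.isClosed.frontier_subset

theorem measure_frontier_lt_top : (μH[1] : Measure Plane) (frontier C) < ∞ := by
  obtain ⟨R, hR, hb⟩ := hC.exists_norm_bound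
  refine lt_of_le_of_lt (hausdorffMeasure_frontier_le hC.nonempty hC.compact.isClosed hC.convex
    (isCompact_frameBox 0 (-R) R (-R) R) fun z hz => ?_) (lt_of_le_of_lt
    (hausdorffMeasure_frontier_frameBox_le 0 (by linarith) (by linarith)) ENNReal.ofReal_lt_top)
  exact ⟨abs_le.1 ((abs_height_le 0 z).trans (hb z hz)), abs_le.1 ((abs_tang_le 0 z).trans (hb z hz))⟩

theorem isFiniteMeasure_bdryMeasure : IsFiniteMeasure (bdryMeasure C) :=
  ⟨by unfold bdryMeasure; rw [Measure.restrict_apply_univ]; exact hC.measure_frontier_lt_top⟩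

theorem lipschitzWith_lowest {R : ℝ} (hb : ∀ z ∈ C, ‖z‖ ≤ R) :
    LipschitzWith R.toNNReal (lowest C) := by
  have hR : 0 ≤ R := by
    obtain ⟨z, hz⟩ := hC.nonempty
    exact (norm_nonneg z).trans (hb z hz)
  refine LipschitzWith.of_le_add_mul _ fun θ θ' => ?_
  rw [Real.coe_toNNReal R hR, Real.dist_eq]
  obtain ⟨z, hz, h⟩ := hC.exists_lowest θ'
  have h1 := hC.lowest_le θ hz
  have h2 := abs_height_sub_height_le θ θ' z
  have h3 := le_abs_self (height θ z - height θ' z)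
  have h4 := mul_le_mul_of_nonneg_right (hb z hz) (abs_nonneg (θ - θ'))
  linarith

theorem abs_deriv_lowest_le {R : ℝ} (hb : ∀ z ∈ C, ‖z‖ ≤ R) (θ : ℝ) :
    |deriv (lowest C) θ| ≤ R := by
  have hR : 0 ≤ R := by
    obtain ⟨z, hz⟩ := hC.nonempty
    exact (norm_nonneg z).trans (hb z hz)
  have := norm_deriv_le_of_lipschitz (x₀ := θ) (hC.lipschitzWith_lowest hb)
  rwa [Real.norm_eq_abs, Real.coe_toNNReal R hR] at this

theorem continuous_lowest : Continuous (lowest C) := by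
  obtain ⟨R, _, hb⟩ := hC.exists_norm_bound
  exact (hC.lipschitzWith_lowest hb).continuous

theorem ae_differentiableAt_lowest : ∀ᵐ θ : ℝ, DifferentiableAt ℝ (lowest C) θ := by
  obtain ⟨R, _, hb⟩ := hC.exists_norm_bound
  exact (hC.lipschitzWith_lowest hb).ae_differentiableAt_real

theorem continuous_gap_uncurry : Continuous fun p : ℝ × Plane => gap C p.1 p.2 :=
  continuous_height_uncurry.sub (hC.continuous_lowest.comp continuous_fst)

theorem continuous_gap (z : Plane) : Continuous fun θ => gap C θ z :=
  hC.continuous_gap_uncurry.comp (Continuous.prodMk_left z)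

/-- The gap of a contact point is nonnegative for all angles and vanishes at `θ`, so its derivative
there is zero. -/
theorem deriv_lowest_eq {θ : ℝ} (hd : DifferentiableAt ℝ (lowest C) θ) {x : Plane} (hx : x ∈ C)
    (h : height θ x = lowest C θ) : deriv (lowest C) θ = tang θ x := by
  have hmin : IsLocalMin (fun θ => gap C θ x) θ := by
    refine Filter.Eventually.of_forall fun θ' => ?_
    have : gap C θ x = 0 := by unfold gap; rw [h, sub_self]
    change gap C θ x ≤ gap C θ' x
    rw [this]; exact hC.gap_nonneg θ' hx
  have := hmin.hasDerivAt_eq_zero (hasDerivAt_gap hd x)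
  linarith

theorem measurable_slopeMass_uncurry (δ : ℝ) :
    Measurable fun p : ℝ × Plane => slopeMass C δ p.1 p.2 := by
  have h1 : MeasurableSet {p : ℝ × Plane | gap C p.1 p.2 < δ} :=
    (isOpen_Iio.preimage hC.continuous_gap_uncurry).measurableSet
  have h2 : Measurable fun p : ℝ × Plane => |tang p.1 p.2 - deriv (lowest C) p.1| :=
    (continuous_tang_uncurry.measurable.sub ((measurable_deriv _).comp measurable_fst)).abs
  exact h2.indicator h1

theorem slopeMass_le {R : ℝ} (hb : ∀ z ∈ C, ‖z‖ ≤ R) (δ θ : ℝ) {z : Plane} (hz : z ∈ C) :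
    slopeMass C δ θ z ≤ 2 * R := by
  refine (Set.indicator_le_self' (fun _ _ => abs_nonneg _) z).trans ?_
  refine (abs_sub _ _).trans ?_
  linarith [hC.abs_deriv_lowest_le hb θ, (abs_tang_le θ z).trans (hb z hz)]

theorem integrable_slopeMass (δ θ : ℝ) : Integrable (slopeMass C δ θ) (bdryMeasure C) := by
  obtain ⟨R, _, hb⟩ := hC.exists_norm_bound
  have := hC.isFiniteMeasure_bdryMeasure
  refine Integrable.of_bound (C := 2 * R)
    ((hC.measurable_slopeMass_uncurry δ).comp measurable_prodMk_left).aestronglyMeasurable ?_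
  filter_upwards [(ae_mem_frontier C)] with z hz
  rw [Real.norm_of_nonneg (slopeMass_nonneg _ _ _ _)]
  exact hC.slopeMass_le hb δ θ (hC.frontier_subset hz)

theorem integrable_slopeMass_uncurry (δ : ℝ) (μ : Measure ℝ) [IsFiniteMeasure μ] :
    Integrable (fun p : ℝ × Plane => slopeMass C δ p.1 p.2) (μ.prod (bdryMeasure C)) := by
  obtain ⟨R, _, hb⟩ := hC.exists_norm_bound
  have := hC.isFiniteMeasure_bdryMeasure
  refine Integrable.of_bound (C := 2 * R) (hC.measurable_slopeMass_uncurry δ).aestronglyMeasurable ?_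
  have h := Measure.quasiMeasurePreserving_snd (μ := μ) (ν := bdryMeasure C) |>.ae
    (ae_mem_frontier C)
  filter_upwards [h] with p hp
  rw [Real.norm_of_nonneg (slopeMass_nonneg _ _ _ _)]
  exact hC.slopeMass_le hb δ p.1 (hC.frontier_subset hp)

theorem exists_frontier_below {θ s t : ℝ} (h : framePt θ s t ∈ C) :
    ∃ z ∈ frontier C, tang θ z = t ∧ gap C θ z ≤ s - lowest C θ := by
  set V := {s | framePt θ s t ∈ C} with hV
  have hcont : Continuous fun s => framePt θ s t :=
    (continuous_framePt θ).comp (Continuous.prodMk_left t)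
  have hcl : IsClosed V := hC.compact.isClosed.preimage hcont
  have hcomp : IsCompact V := (hC.compact.image (continuous_height θ)).of_isClosed_subset hcl
    fun s hs => ⟨_, hs, height_framePt θ s t⟩
  have hmem : sInf V ∈ V := hcomp.sInf_mem ⟨s, h⟩
  refine ⟨framePt θ (sInf V) t, ⟨subset_closure hmem, fun hint => ?_⟩, tang_framePt _ _ _, ?_⟩
  · have hnhds : ∀ᶠ s in 𝓝 (sInf V), framePt θ s t ∈ C :=
      (hcont.continuousAt).eventually (mem_interior_iff_mem_nhds.1 hint)
    obtain ⟨ε, hε, hball⟩ := Metric.eventually_nhds_iff.1 hnhds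
    have h1 : framePt θ (sInf V - ε / 2) t ∈ C := hball (by
      rw [Real.dist_eq, sub_sub_cancel_left, abs_neg, abs_of_pos (by linarith)]; linarith)
    have h2 := csInf_le hcomp.bddBelow (show sInf V - ε / 2 ∈ V from h1)
    linarith
  · unfold gap
    rw [height_framePt]
    have := csInf_le hcomp.bddBelow (show s ∈ V from h)
    linarith

/-- The square of a chord is controlled by the integral of `slopeMass` along the boundary. -/
theorem chord_sq_le (θ : ℝ) {δ δ' : ℝ} (hδ : δ < δ') :
    chord C θ (lowest C θ + δ) ^ 2 ≤ 8 * ∫ z, slopeMass C δ' θ z ∂(bdryMeasure C) := by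
  set w := chord C θ (lowest C θ + δ) with hw
  set τ := deriv (lowest C) θ
  have hfin := hC.isFiniteMeasure_bdryMeasure
  have hint0 : 0 ≤ ∫ z, slopeMass C δ' θ z ∂(bdryMeasure C) :=
    integral_nonneg fun z => slopeMass_nonneg _ _ _ _
  have hw0 : 0 ≤ w := measureReal_nonneg
  rcases eq_or_lt_of_le hw0 with h0 | hpos
  · rw [← h0]; linarith
  set S := {t | framePt θ (lowest C θ + δ) t ∈ C} with hS
  -- Outside this interval a part of the slice of length at least `w/2` remains. It lies over
  -- boundary points of slope at least `w/4`, and `tang θ` does not increase length, so Markov's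
  -- inequality gives `w²/8`. Nothing about the centre `τ` is needed.
  set I := Set.Ioo (τ - w / 4) (τ + w / 4)
  set T := {z | w / 4 ≤ slopeMass C δ' θ z} with hT
  have hSfin : volume S ≠ ∞ := (hC.isCompact_slice θ _).measure_lt_top.ne
  have himg : S \ I ⊆ tang θ '' (T ∩ frontier C) := by
    rintro t ⟨htS, htI⟩
    obtain ⟨z, hz, hzt, hzg⟩ := hC.exists_frontier_below htS
    refine ⟨z, ⟨?_, hz⟩, hzt⟩
    rw [hT, Set.mem_ofPred_eq]
    unfold slopeMass
    rw [Set.indicator_of_mem (by rw [Set.mem_ofPred_eq]; linarith), hzt]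
    by_contra hlt
    push Not at hlt
    rw [abs_lt] at hlt
    exact htI ⟨by linarith [hlt.1], by linarith [hlt.2]⟩
  have h1 : volume (S \ I) ≤ (bdryMeasure C) T := by
    calc volume (S \ I) ≤ volume (tang θ '' (T ∩ frontier C)) := measure_mono himg
      _ ≤ (μH[1] : Measure Plane) (T ∩ frontier C) := by
          have := (lipschitzWith_tang θ).hausdorffMeasure_image_le zero_le_one (T ∩ frontier C)
          simpa [hausdorffMeasure_real] using this
      _ ≤ _ := Measure.le_restrict_apply _ _
  have h2 : w / 2 ≤ (bdryMeasure C).real T := by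
    have h3 : volume.real S ≤ volume.real (S \ I) + volume.real I := by
      have := measureReal_union_le (μ := volume) (S \ I) I
      refine le_trans (measureReal_mono (by intro x hx; by_cases hxI : x ∈ I <;> simp [hx, hxI])
        ?_) this
      exact ((measure_union_le _ _).trans_lt (ENNReal.add_lt_top.2
        ⟨(measure_mono Set.sdiff_subset).trans_lt hSfin.lt_top, measure_Ioo_lt_top⟩)).ne
    have h4 : volume.real (S \ I) ≤ (bdryMeasure C).real T :=
      ENNReal.toReal_mono (measure_ne_top _ _) h1
    have h5 : volume.real I = w / 2 := by
      rw [Real.volume_real_Ioo, max_eq_left (by linarith)]; ring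
    have h6 : volume.real S = w := rfl
    linarith
  have h3 := mul_meas_ge_le_integral_of_nonneg (μ := bdryMeasure C)
    (ae_of_all _ fun z => slopeMass_nonneg C δ' θ z) (hC.integrable_slopeMass δ' θ) (w / 4)
  nlinarith

/-- Moving from `z` towards the centre of the inscribed ball, which has height at least `r`, reaches
height `δ` after a fraction at most `δ/r` of a segment of length at most `D`. -/
theorem exists_slice_near {c : Plane} {r D : ℝ} (hr : 0 < r) (hcr : Metric.closedBall c r ⊆ C)
    (hD : ∀ x ∈ C, ∀ y ∈ C, dist x y ≤ D) {θ δ : ℝ} (hδ : 0 < δ) (hδr : δ ≤ r) {z : Plane}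
    (hz : z ∈ C) (hg : gap C θ z ≤ δ) :
    ∃ t ∈ {t | framePt θ (lowest C θ + δ) t ∈ C}, |t - tang θ z| ≤ D * δ / r := by
  have hcC : c ∈ C := hcr (Metric.mem_closedBall_self hr.le)
  have hY : r ≤ gap C θ c := by have := hC.lowest_add_le hr hcr θ; unfold gap; linarith
  have hy := hC.gap_nonneg θ hz
  set y := gap C θ z with hyd
  set Y := gap C θ c with hYd
  set l := (δ - y) / (Y - y) with hl
  have hl0 : 0 ≤ l := div_nonneg (by linarith) (by linarith)
  have hl1 : l ≤ 1 := div_le_one_of_le₀ (by linarith) (by linarith)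
  have hlr : l ≤ δ / r := by
    -- Equality forces `y = δ = r = Y`; then `l` is zero by the convention on division by zero, as
    -- wanted.
    rcases eq_or_lt_of_le (show y ≤ Y by linarith) with h | h
    · rw [hl, h, sub_self, div_zero]; positivity
    · rw [hl, div_le_div_iff₀ (by linarith) hr]
      nlinarith
  have hlY : l * (Y - y) = δ - y := by
    rcases eq_or_lt_of_le (show y ≤ Y by linarith) with h | h
    · rw [h, sub_self, mul_zero]; linarith
    · rw [hl, div_mul_cancel₀]; linarith
  set p := z + l • (c - z) with hp
  have hpC : p ∈ C := hC.convex.add_smul_sub_mem hz hcC ⟨hl0, hl1⟩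
  have hph : height θ p = lowest C θ + δ := by
    rw [hp, height_add, height_smul, height_sub]
    have e1 : height θ c = Y + lowest C θ := by rw [hYd]; unfold gap; ring
    have e2 : height θ z = y + lowest C θ := by rw [hyd]; unfold gap; ring
    rw [e1, e2]
    linarith
  refine ⟨tang θ p, ?_, ?_⟩
  · rw [Set.mem_ofPred_eq, ← hph, framePt_height_tang]; exact hpC
  · have e : tang θ p - tang θ z = l * (tang θ c - tang θ z) := by
      rw [hp, tang_add, tang_smul, tang_sub]; ring
    rw [e, abs_mul, abs_of_nonneg hl0]
    have h1 := (abs_tang_sub_le θ c z).trans (hD c hcC z hz)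
    calc l * |tang θ c - tang θ z| ≤ (δ / r) * D := by gcongr
      _ = _ := by ring

theorem abs_sub_le_chord {θ s t t' : ℝ} (h : framePt θ s t ∈ C) (h' : framePt θ s t' ∈ C) :
    |t - t'| ≤ chord C θ s := by
  have hs : s ∈ Set.Icc (lowest C θ) (highest C θ) := by
    have h1 := hC.lowest_le θ h
    have h2 := hC.le_highest θ h
    rw [height_framePt] at h1 h2
    exact ⟨h1, h2⟩
  rw [hC.chord_eq hs]
  have hb := hC.isCompact_slice θ s
  have a1 := csInf_le hb.bddBelow h
  have a2 := le_csSup hb.bddAbove h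
  have b1 := csInf_le hb.bddBelow h'
  have b2 := le_csSup hb.bddAbove h'
  rw [abs_le]; constructor <;> linarith

/-- The integral of `slopeMass` along the boundary is controlled by the square of a chord, up to
a term of second order. -/
theorem integral_slopeMass_le {c : Plane} {r D : ℝ} (hr : 0 < r) (hcr : Metric.closedBall c r ⊆ C)
    (hD : ∀ x ∈ C, ∀ y ∈ C, dist x y ≤ D) {θ δ : ℝ} (hδ : 0 < δ) (hδr : δ ≤ r)
    (hd : DifferentiableAt ℝ (lowest C) θ) :
    ∫ z, slopeMass C δ θ z ∂(bdryMeasure C)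
      ≤ 10 * chord C θ (lowest C θ + δ) ^ 2 + (10 * (2 * D / r) ^ 2 + 1) * δ ^ 2 := by
  have hfin := hC.isFiniteMeasure_bdryMeasure
  set w := chord C θ (lowest C θ + δ) with hw
  have hw0 : 0 ≤ w := measureReal_nonneg
  obtain ⟨x, hx, hxl⟩ := hC.exists_lowest θ
  have hD0 : 0 ≤ D := dist_nonneg.trans (hD x hx x hx)
  have hxg : gap C θ x ≤ δ := by unfold gap; rw [hxl, sub_self]; exact hδ.le
  -- Moving both `z` and the contact point `x` to the slice at height `δ` costs `Dδ/r` each, and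
  -- within the slice they differ by at most `w`.
  set E := w + 2 * D / r * δ with hE
  have hE0 : 0 ≤ E := by positivity
  have hext : ∀ z ∈ C, gap C θ z ≤ δ → |tang θ z - tang θ x| ≤ E := by
    intro z hz hzg
    obtain ⟨p, hp, hp'⟩ := hC.exists_slice_near hr hcr hD hδ hδr hz hzg
    obtain ⟨q, hq, hq'⟩ := hC.exists_slice_near hr hcr hD hδ hδr hx hxg
    have hpq := hC.abs_sub_le_chord hp hq
    have e : 2 * D / r * δ = D * δ / r + D * δ / r := by ring
    rw [hE, e]
    rw [abs_le] at *
    constructor <;> linarith [hp'.1, hp'.2, hq'.1, hq'.2, hpq.1, hpq.2]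
  set K := {z ∈ C | gap C θ z ≤ δ} with hK
  have hgc : Continuous (gap C θ) := (continuous_height θ).sub continuous_const
  have hKcl : IsClosed K := hC.compact.isClosed.inter (isClosed_Iic.preimage hgc)
  have hKconv : Convex ℝ K := by
    rintro y ⟨hy, hyg⟩ y' ⟨hy', hyg'⟩ p q hp hq hpq
    refine ⟨hC.convex hy hy' hp hq hpq, ?_⟩
    unfold gap at hyg hyg' ⊢
    rw [height_add, height_smul, height_smul]
    have : q = 1 - p := by linarith
    subst this
    nlinarith
  have hKbox : K ⊆ frameBox θ (lowest C θ) (lowest C θ + δ) (tang θ x - E) (tang θ x + E) := by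
    rintro z ⟨hz, hzg⟩
    have h1 := hC.lowest_le θ hz
    have h2 := abs_le.1 (hext z hz hzg)
    unfold gap at hzg
    exact ⟨⟨h1, by linarith⟩, ⟨by linarith [h2.1], by linarith [h2.2]⟩⟩
  have hKm : (μH[1] : Measure Plane) (frontier K) ≤ ENNReal.ofReal (2 * δ + 4 * E) := by
    have hKne : K.Nonempty := ⟨x, hx, hxg⟩
    refine (hausdorffMeasure_frontier_le hKne hKcl hKconv
      (isCompact_frameBox _ _ _ _ _) hKbox).trans ?_
    refine (hausdorffMeasure_frontier_frameBox_le θ (by linarith) (by linarith)).trans ?_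
    exact ENNReal.ofReal_le_ofReal (by linarith)
  set G := {z | gap C θ z < δ} with hG
  have hGm : MeasurableSet G := (isOpen_Iio.preimage hgc).measurableSet
  have hGK : G ∩ frontier C ⊆ frontier K := by
    rintro z ⟨hzG, hz⟩
    refine ⟨subset_closure ⟨hC.frontier_subset hz, le_of_lt hzG⟩, fun hint => hz.2 ?_⟩
    exact interior_mono (fun y hy => hy.1) hint
  have hGmeas : (bdryMeasure C).real G ≤ 2 * δ + 4 * E := by
    have h1 : (bdryMeasure C) G ≤ ENNReal.ofReal (2 * δ + 4 * E) := by
      unfold bdryMeasure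
      rw [Measure.restrict_apply hGm]
      exact (measure_mono hGK).trans hKm
    exact ENNReal.toReal_le_of_le_ofReal (by positivity) h1
  have hle : ∫ z, slopeMass C δ θ z ∂(bdryMeasure C)
      ≤ ∫ z, G.indicator (fun _ => E) z ∂(bdryMeasure C) := by
    refine integral_mono_ae (hC.integrable_slopeMass δ θ)
      ((integrable_const E).indicator hGm) ?_
    filter_upwards [(ae_mem_frontier C)] with z hz
    unfold slopeMass
    by_cases h : z ∈ G
    · rw [Set.indicator_of_mem h, Set.indicator_of_mem h, hC.deriv_lowest_eq hd hx hxl]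
      exact hext z (hC.frontier_subset hz) (le_of_lt h)
    · rw [Set.indicator_of_notMem h, Set.indicator_of_notMem h]
  rw [integral_indicator hGm, setIntegral_const, smul_eq_mul] at hle
  -- The cap lies in a box of sides `δ` and `2E`, whence the length `2δ + 4E`. The product is at
  -- most `δ² + 5E²`, and `E²` is at most twice the sum of the squares of its terms.
  have h1 : (bdryMeasure C).real G * E ≤ (2 * δ + 4 * E) * E :=
    mul_le_mul_of_nonneg_right hGmeas hE0
  have h2 : E ^ 2 ≤ 2 * w ^ 2 + 2 * (2 * D / r) ^ 2 * δ ^ 2 := by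
    rw [hE]; nlinarith [sq_nonneg (w - 2 * D / r * δ)]
  nlinarith [sq_nonneg (δ - E)]

end IsCompactBody

/-! ### Variation of the gap of a fixed boundary point as the angle turns. -/

theorem height_sub_angle (θ φ : ℝ) (z : Plane) :
    height (θ - φ) z = Real.cos φ * height θ z - Real.sin φ * tang θ z := by
  simp only [height, tang, Real.cos_sub, Real.sin_sub]; ring

theorem height_add_angle (θ φ : ℝ) (z : Plane) :
    height (θ + φ) z = Real.cos φ * height θ z + Real.sin φ * tang θ z := by
  simp only [height, tang, Real.cos_add, Real.sin_add]; ring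

theorem height_add_two_pi (θ : ℝ) (z : Plane) : height (θ + 2 * Real.pi) z = height θ z := by
  simp only [height, Real.cos_add_two_pi, Real.sin_add_two_pi]

theorem tang_add_two_pi (θ : ℝ) (z : Plane) : tang (θ + 2 * Real.pi) z = tang θ z := by
  simp only [tang, Real.cos_add_two_pi, Real.sin_add_two_pi]

theorem lowest_periodic (C : Set Plane) : Function.Periodic (lowest C) (2 * Real.pi) := fun θ => by
  unfold lowest
  congr 1
  exact Set.image_congr fun z _ => height_add_two_pi θ z

theorem gap_periodic (C : Set Plane) (z : Plane) :
    Function.Periodic (fun θ => gap C θ z) (2 * Real.pi) := fun θ => by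
  simp only [gap, height_add_two_pi, lowest_periodic C θ]

theorem slopeMass_periodic (C : Set Plane) (δ : ℝ) (z : Plane) :
    Function.Periodic (fun θ => slopeMass C δ θ z) (2 * Real.pi) := fun θ => by
  have h : deriv (lowest C) (θ + 2 * Real.pi) = deriv (lowest C) θ := by
    rw [← deriv_comp_add_const]
    congr 1
    ext x
    exact lowest_periodic C x
  have hg : ∀ w, gap C (θ + 2 * Real.pi) w = gap C θ w := fun w => gap_periodic C w θ
  simp only [slopeMass, h, hg, tang_add_two_pi]

/-- The indicator of the set of angles for which the gap of `z` is positive and less than `δ`. -/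
def nearIndicator (C : Set Plane) (δ : ℝ) (z : Plane) (θ : ℝ) : ℝ :=
  {θ | 0 < gap C θ z ∧ gap C θ z < δ}.indicator (fun _ => (1 : ℝ)) θ

theorem nearIndicator_periodic (C : Set Plane) (δ : ℝ) (z : Plane) :
    Function.Periodic (nearIndicator C δ z) (2 * Real.pi) := fun θ => by
  have hg : gap C (θ + 2 * Real.pi) z = gap C θ z := gap_periodic C z θ
  by_cases h : 0 < gap C θ z ∧ gap C θ z < δ
  · rw [nearIndicator, nearIndicator, Set.indicator_of_mem (by simpa [hg] using h),
      Set.indicator_of_mem (by simpa using h)]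
  · rw [nearIndicator, nearIndicator, Set.indicator_of_notMem (by simpa [hg] using h),
      Set.indicator_of_notMem (by simpa using h)]

theorem exists_angle (v : Plane) : ∃ θ : ℝ, ∀ z : Plane, inner ℝ v z = ‖v‖ * height θ z := by
  set w : ℂ := ⟨v 0, v 1⟩ with hw
  have hn : ‖w‖ = ‖v‖ := by
    rw [← pow_left_inj₀ (norm_nonneg _) (norm_nonneg _) two_ne_zero, EuclideanSpace.norm_sq_eq,
      Fin.sum_univ_two, Complex.sq_norm, Complex.normSq_apply]
    simp [hw, sq]
  refine ⟨w.arg, fun z => ?_⟩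
  have h0 : ‖v‖ * Real.cos w.arg = v 0 := by rw [← hn]; exact Complex.norm_mul_cos_arg w
  have h1 : ‖v‖ * Real.sin w.arg = v 1 := by rw [← hn]; exact Complex.norm_mul_sin_arg w
  have : inner ℝ v z = v 0 * z 0 + v 1 * z 1 := by
    simp [PiLp.inner_apply, Fin.sum_univ_two, mul_comm]
  rw [this, ← h0, ← h1]
  unfold height
  ring

namespace IsCompactBody

variable {C : Set Plane} (hC : IsCompactBody C)
include hC

theorem exists_gap_eq_zero {z : Plane} (hz : z ∈ frontier C) : ∃ θ, gap C θ z = 0 := by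
  obtain ⟨f, hf⟩ := geometric_hahn_banach_open_point hC.convex.interior isOpen_interior hz.2
  set v : Plane := (InnerProductSpace.toDual ℝ Plane).symm f with hv
  obtain ⟨θ, hθ⟩ := exists_angle v
  have hfv : ∀ x, f x = ‖v‖ * height θ x := fun x => by
    rw [← hθ, hv, InnerProductSpace.toDual_symm_apply]
  obtain ⟨x₀, hx₀⟩ := hC.interior_nonempty
  have hvpos : 0 < ‖v‖ := by
    rcases eq_or_lt_of_le (norm_nonneg v) with h | h
    · have := hf x₀ hx₀
      rw [hfv, hfv, ← h] at this
      simp at this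
    · exact h
  have hlt : ∀ x ∈ interior C, height θ x ≤ height θ z := fun x hx => by
    have := hf x hx
    rw [hfv, hfv] at this
    exact (lt_of_mul_lt_mul_left this hvpos.le).le
  have hall : ∀ x ∈ C, height θ x ≤ height θ z := by
    intro x hx
    have hcl : closure (interior C) ⊆ {x | height θ x ≤ height θ z} :=
      closure_minimal hlt (isClosed_Iic.preimage (continuous_height θ))
    rw [hC.convex.closure_interior_eq_closure_of_nonempty_interior hC.interior_nonempty] at hcl
    exact hcl (subset_closure hx)
  -- Separation makes `z` highest in direction `θ`, hence lowest in the opposite one.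
  refine ⟨θ + Real.pi, ?_⟩
  have hzC := hC.frontier_subset hz
  apply le_antisymm _ (hC.gap_nonneg _ hzC)
  obtain ⟨x, hx, hxl⟩ := hC.exists_lowest (θ + Real.pi)
  unfold gap
  rw [← hxl, height_add_pi, height_add_pi]
  linarith [hall x hx]

/-- The key differential inequality for the gap function. -/
theorem cos_mul_gap_le {z : Plane} {θ φ : ℝ} (hd : DifferentiableAt ℝ (lowest C) θ)
    (h0 : gap C (θ - φ) z = 0) :
    Real.cos φ * gap C θ z ≤ Real.sin φ * (tang θ z - deriv (lowest C) θ) := by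
  obtain ⟨x, hx, hxl⟩ := hC.exists_lowest θ
  rw [hC.deriv_lowest_eq hd hx hxl]
  have h1 := hC.lowest_le (θ - φ) hx
  unfold gap at h0 ⊢
  rw [← hxl]
  have h2 : height (θ - φ) z ≤ height (θ - φ) x := by linarith
  rw [height_sub_angle, height_sub_angle] at h2
  linarith

/-- A point low in direction `θ` cannot be lowest in a nearly opposite direction, because the body
contains a ball of radius `r`. This keeps `sin φ` away from zero when `cos φ ≤ 0`. -/
theorem half_radius_le {c : Plane} {r D : ℝ} (hr : 0 < r) (hcr : Metric.closedBall c r ⊆ C)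
    (hD : ∀ x ∈ C, ∀ y ∈ C, dist x y ≤ D) {z : Plane} (hz : z ∈ C) {θ φ : ℝ}
    (h0 : gap C (θ - φ) z = 0) (hg : gap C θ z ≤ r / 2) (hcos : Real.cos φ ≤ 0) :
    r / 2 ≤ |Real.sin φ| * D := by
  have hcC : c ∈ C := hcr (Metric.mem_closedBall_self hr.le)
  have h1 := hC.lowest_add_le hr hcr θ
  have h2 := hC.lowest_add_le hr hcr (θ - φ)
  unfold gap at h0 hg
  have h3 := height_add_angle (θ - φ) φ (z - c)
  rw [sub_add_cancel, height_sub, height_sub] at h3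
  have h4 : |tang (θ - φ) (z - c)| ≤ D := by
    rw [tang_sub]; exact (abs_tang_sub_le _ z c).trans (hD z hz c hcC)
  have h5 : 0 ≤ Real.cos φ * (height (θ - φ) z - height (θ - φ) c) :=
    mul_nonneg_of_nonpos_of_nonpos hcos (by linarith)
  have h6 : -(Real.sin φ * tang (θ - φ) (z - c)) ≤ |Real.sin φ| * D := by
    calc _ ≤ |Real.sin φ * tang (θ - φ) (z - c)| := neg_le_abs _
      _ = |Real.sin φ| * |tang (θ - φ) (z - c)| := abs_mul _ _
      _ ≤ _ := by gcongr
  linarith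

/-- For angles on either side of a normal at `z`, the gap of `z` is almost monotone
while it is small. -/
theorem abs_slope_le {c : Plane} {r D : ℝ} (hr : 0 < r) (hcr : Metric.closedBall c r ⊆ C)
    (hD : ∀ x ∈ C, ∀ y ∈ C, dist x y ≤ D) {z : Plane} (hz : z ∈ C) {θ φ σ : ℝ}
    (hσ : σ = 1 ∨ σ = -1) (hsin : 0 < σ * Real.sin φ)
    (hd : DifferentiableAt ℝ (lowest C) θ)
    (h0 : gap C (θ - φ) z = 0) (hg : gap C θ z ≤ r / 2) :
    |tang θ z - deriv (lowest C) θ|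
      ≤ σ * (tang θ z - deriv (lowest C) θ) + 2 * (2 * D / r) * gap C θ z := by
  have key := hC.cos_mul_gap_le hd h0
  have hg0 := hC.gap_nonneg θ hz
  have hD0 : 0 ≤ D := dist_nonneg.trans (hD z hz z hz)
  set q := tang θ z - deriv (lowest C) θ
  have hM : 0 ≤ 2 * D / r := by positivity
  have habs : |q| = |σ * q| := by rcases hσ with rfl | rfl <;> simp
  have hσσ : Real.sin φ * q = (σ * Real.sin φ) * (σ * q) := by
    rcases hσ with rfl | rfl <;> ring
  have habss : |Real.sin φ| = σ * Real.sin φ := by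
    rcases hσ with rfl | rfl
    · rw [one_mul] at hsin ⊢; exact abs_of_pos hsin
    · rw [neg_one_mul] at hsin ⊢; exact abs_of_neg (by linarith)
  rw [hσσ] at key
  rw [habs]
  set s := σ * Real.sin φ
  -- If `cos φ ≥ 0`, the differential inequality gives `σ * q ≥ 0`. Otherwise `s` is at least
  -- `r/(2D)`, and dividing `s * (σ * q) ≥ -gap` by it loses the factor `2D/r`.
  have main : -(2 * D / r * gap C θ z) ≤ σ * q := by
    by_contra hlt
    push Not at hlt
    have h1 := mul_lt_mul_of_pos_left hlt hsin
    rcases le_or_gt 0 (Real.cos φ) with hc | hc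
    · have h2 : 0 ≤ s * (2 * D / r * gap C θ z) := by positivity
      have h3 : 0 ≤ Real.cos φ * gap C θ z := mul_nonneg hc hg0
      have h4 : 0 ≤ s * (σ * q) := h3.trans key
      have h5 : 0 ≤ σ * q := nonneg_of_mul_nonneg_right h4 hsin
      nlinarith [mul_nonneg hM hg0]
    · have h2 := hC.half_radius_le hr hcr hD hz h0 hg hc.le
      rw [habss] at h2
      have h3 : 1 ≤ s * (2 * D / r) := by
        rw [← mul_div_assoc, le_div_iff₀ hr]; linarith
      have h4 := Real.neg_one_le_cos φ
      nlinarith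
  rcases abs_cases (σ * q) with ⟨h, _⟩ | ⟨h, _⟩
  · rw [h]; nlinarith [mul_nonneg hM hg0]
  · rw [h]; linarith

theorem lipschitz_min_gap (δ : ℝ) (z : Plane) :
    ∃ K : NNReal, LipschitzWith K fun θ => min (gap C θ z) δ := by
  obtain ⟨R, _, hb⟩ := hC.exists_norm_bound
  have h1 : LipschitzWith ‖z‖.toNNReal fun θ => height θ z :=
    LipschitzWith.of_dist_le_mul fun θ θ' => by
      rw [Real.coe_toNNReal _ (norm_nonneg z), Real.dist_eq, Real.dist_eq]
      exact abs_height_sub_height_le θ θ' z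
  have h2 := h1.sub (hC.lipschitzWith_lowest hb)
  exact ⟨_, h2.min_const δ⟩

theorem integral_deriv_min_gap (δ : ℝ) (z : Plane) (p q : ℝ) :
    IntervalIntegrable (deriv fun θ => min (gap C θ z) δ) volume p q ∧
    ∫ θ in p..q, deriv (fun θ => min (gap C θ z) δ) θ = min (gap C q z) δ - min (gap C p z) δ := by
  obtain ⟨K, hK⟩ := hC.lipschitz_min_gap δ z
  have := (hK.lipschitzOnWith (s := Set.uIcc p q)).absolutelyContinuousOnInterval
  exact ⟨this.intervalIntegrable_deriv, this.integral_deriv_eq_sub⟩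

/-- Where the gap equals `δ` the truncated function has a maximum, so its derivative vanishes, in
agreement with the strict cutoff. -/
theorem ae_deriv_min_gap (δ : ℝ) (z : Plane) : ∀ᵐ θ : ℝ,
    deriv (fun θ => min (gap C θ z) δ) θ
      = {w | gap C θ w < δ}.indicator (fun w => tang θ w - deriv (lowest C) θ) z := by
  obtain ⟨K, hK⟩ := hC.lipschitz_min_gap δ z
  filter_upwards [hC.ae_differentiableAt_lowest, hK.ae_differentiableAt_real] with θ h1 h2
  have hc := (hC.continuous_gap z).continuousAt (x := θ)
  rcases lt_trichotomy (gap C θ z) δ with h | h | h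
  · rw [Set.indicator_of_mem (by exact h)]
    have he : (fun θ => min (gap C θ z) δ) =ᶠ[𝓝 θ] fun θ => gap C θ z := by
      filter_upwards [hc.eventually (gt_mem_nhds h)] with θ' h'
      exact min_eq_left (le_of_lt h')
    rw [he.deriv_eq]
    exact (hasDerivAt_gap h1 z).deriv
  · rw [Set.indicator_of_notMem (by rw [Set.mem_ofPred_eq, h]; exact lt_irrefl _)]
    have hmax : IsLocalMax (fun θ => min (gap C θ z) δ) θ :=
      Filter.Eventually.of_forall fun θ' => by
        change min (gap C θ' z) δ ≤ min (gap C θ z) δ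
        rw [h, min_self]; exact min_le_right _ _
    exact hmax.deriv_eq_zero
  · rw [Set.indicator_of_notMem (by rw [Set.mem_ofPred_eq]; exact not_lt.2 h.le)]
    have he : (fun θ => min (gap C θ z) δ) =ᶠ[𝓝 θ] fun _ => δ := by
      filter_upwards [hc.eventually (lt_mem_nhds h)] with θ' h'
      exact min_eq_right (le_of_lt h')
    rw [he.deriv_eq, deriv_const]

theorem ae_slopeMass_eq (δ : ℝ) (z : Plane) : ∀ᵐ θ : ℝ,
    slopeMass C δ θ z = |deriv (fun θ => min (gap C θ z) δ) θ| := by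
  filter_upwards [hC.ae_deriv_min_gap δ z] with θ h
  rw [h]
  unfold slopeMass
  by_cases hz : z ∈ {w | gap C θ w < δ}
  · rw [Set.indicator_of_mem hz, Set.indicator_of_mem hz]
  · rw [Set.indicator_of_notMem hz, Set.indicator_of_notMem hz, abs_zero]

theorem intervalIntegrable_slopeMass (δ : ℝ) (z : Plane) (p q : ℝ) :
    IntervalIntegrable (fun θ => slopeMass C δ θ z) volume p q := by
  have h := (hC.integral_deriv_min_gap δ z p q).1.abs
  refine h.congr_ae ?_
  filter_upwards [ae_restrict_of_ae (hC.ae_slopeMass_eq δ z)] with θ hθ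
  exact hθ.symm

theorem intervalIntegrable_nearIndicator (δ : ℝ) (z : Plane) (p q : ℝ) :
    IntervalIntegrable (nearIndicator C δ z) volume p q := by
  have hm : MeasurableSet {θ | 0 < gap C θ z ∧ gap C θ z < δ} :=
    ((isOpen_Ioi.inter isOpen_Iio).preimage (hC.continuous_gap z)).measurableSet
  rw [intervalIntegrable_iff]
  exact (integrableOn_const (by simp)).indicator hm

/-- Lower bound for the mass of a boundary point. -/
theorem le_integral_slopeMass {α β δ : ℝ} (hδ : 0 ≤ δ) {z : Plane} {θ₀ θ₁ : ℝ}
    (h₀ : θ₀ ∈ Set.Icc α β) (h₁ : θ₁ ∈ Set.Icc α β) (hg₀ : gap C θ₀ z = 0) (hg₁ : δ ≤ gap C θ₁ z) :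
    δ ≤ ∫ θ in α..β, slopeMass C δ θ z := by
  have h := (hC.integral_deriv_min_gap δ z θ₀ θ₁).2
  rw [min_eq_right hg₁, hg₀, min_eq_left hδ, sub_zero] at h
  have hab : α ≤ β := h₀.1.trans h₀.2
  have e : ∀ p q : ℝ, ∫ θ in p..q, slopeMass C δ θ z
      = ∫ θ in p..q, |deriv (fun θ => min (gap C θ z) δ) θ| := fun p q =>
    intervalIntegral.integral_congr_ae (by
      filter_upwards [hC.ae_slopeMass_eq δ z] with θ hθ _
      exact hθ)
  calc δ ≤ |∫ θ in θ₀..θ₁, deriv (fun θ => min (gap C θ z) δ) θ| := by rw [h]; exact le_abs_self δ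
    _ ≤ |(∫ θ in θ₀..θ₁, |deriv (fun θ => min (gap C θ z) δ) θ|)| := by
        simpa only [Real.norm_eq_abs] using intervalIntegral.norm_integral_le_abs_integral_norm
          (μ := volume) (f := deriv fun θ => min (gap C θ z) δ) (a := θ₀) (b := θ₁)
    _ = |∫ θ in θ₀..θ₁, slopeMass C δ θ z| := by rw [e]
    _ ≤ ∫ θ in α..β, slopeMass C δ θ z := by
        have h2 := intervalIntegral.abs_integral_mono_interval (μ := volume)
          (f := fun θ => slopeMass C δ θ z) (a := θ₀) (b := θ₁) (c := α) (d := β)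
          (by
            rw [Set.uIoc_of_le hab]
            exact Set.Ioc_subset_Ioc (le_min h₀.1 h₁.1) (max_le h₀.2 h₁.2))
          (ae_of_all _ fun θ => slopeMass_nonneg _ _ _ _)
          (hC.intervalIntegrable_slopeMass δ z α β)
        rwa [abs_of_nonneg (a := ∫ θ in α..β, slopeMass C δ θ z)
          (intervalIntegral.integral_nonneg hab fun θ _ => slopeMass_nonneg _ _ _ _)] at h2

/-- Upper bound for the mass of a boundary point. -/
theorem integral_slopeMass_le_of_mem_frontier {c : Plane} {r D : ℝ} (hr : 0 < r)
    (hcr : Metric.closedBall c r ⊆ C) (hD : ∀ x ∈ C, ∀ y ∈ C, dist x y ≤ D) {z : Plane}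
    (hz : z ∈ frontier C) {δ : ℝ} (hδ : 0 < δ) (hδr : δ ≤ r / 2) (α : ℝ) :
    ∫ θ in α..(α + 2 * Real.pi), slopeMass C δ θ z
      ≤ 2 * δ + 2 * (2 * D / r) * δ * ∫ θ in α..(α + 2 * Real.pi), nearIndicator C δ z θ := by
  set M := 2 * (2 * D / r) with hM
  have hzC := hC.frontier_subset hz
  have hD0 : 0 ≤ D := dist_nonneg.trans (hD z hzC z hzC)
  have hM0 : 0 ≤ M := by positivity
  obtain ⟨θ₁, hθ₁⟩ := hC.exists_gap_eq_zero hz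
  have hpi := Real.pi_pos
  -- With the defect of monotonicity removed, `H` is bounded by the signed derivative of `min (gap)
  -- δ` on each half turn from the normal `θ₁`. That function starts at 0 and never exceeds `δ`, so
  -- each half contributes at most `δ`.
  set H : ℝ → ℝ := fun θ => slopeMass C δ θ z - M * δ * nearIndicator C δ z θ with hH
  have hHper : Function.Periodic H (2 * Real.pi) := fun θ => by
    have h1 : slopeMass C δ (θ + 2 * Real.pi) z = slopeMass C δ θ z := slopeMass_periodic C δ z θ
    simp only [hH, h1, nearIndicator_periodic C δ z θ]
  have hint : ∀ p q, IntervalIntegrable H volume p q := fun p q =>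
    (hC.intervalIntegrable_slopeMass δ z p q).sub
      ((hC.intervalIntegrable_nearIndicator δ z p q).const_mul _)
  have hgap : ∀ σ θ : ℝ, (σ = 1 ∨ σ = -1) → 0 < σ * Real.sin (θ - θ₁) →
      DifferentiableAt ℝ (lowest C) θ →
      H θ ≤ σ * {w | gap C θ w < δ}.indicator (fun w => tang θ w - deriv (lowest C) θ) z := by
    intro σ θ hσ hs hd
    have hg0 := hC.gap_nonneg θ hzC
    simp only [hH]
    by_cases hlt : gap C θ z < δ
    · have h1 := hC.abs_slope_le hr hcr hD hzC hσ hs hd (by rwa [sub_sub_cancel])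
        (hlt.le.trans hδr)
      have h2 : gap C θ z ≤ δ * nearIndicator C δ z θ := by
        unfold nearIndicator
        rcases eq_or_lt_of_le hg0 with h0 | h0
        · rw [← h0]
          exact mul_nonneg hδ.le (Set.indicator_nonneg (fun _ _ => zero_le_one) _)
        · rw [Set.indicator_of_mem (show θ ∈ {θ | 0 < gap C θ z ∧ gap C θ z < δ} from ⟨h0, hlt⟩)]
          linarith
      unfold slopeMass
      rw [Set.indicator_of_mem (by exact hlt), Set.indicator_of_mem (by exact hlt)]
      have h3 := mul_le_mul_of_nonneg_left h2 hM0
      rw [← hM] at h1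
      linarith
    · have e1 : slopeMass C δ θ z = 0 := Set.indicator_of_notMem (by exact hlt) _
      have e2 : nearIndicator C δ z θ = 0 := Set.indicator_of_notMem (fun h => hlt h.2) _
      rw [e1, e2, Set.indicator_of_notMem (by exact hlt)]
      simp
  have hne : ∀ᵐ θ : ℝ, θ ≠ θ₁ ∧ θ ≠ θ₁ + Real.pi := by
    have : ∀ᵐ θ : ℝ, θ ∉ ({θ₁, θ₁ + Real.pi} : Set ℝ) :=
      measure_eq_zero_iff_ae_notMem.1 ((Set.toFinite _).measure_zero volume)
    filter_upwards [this] with θ h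
    simpa using h
  have hright : ∫ θ in θ₁..(θ₁ + Real.pi), H θ ≤ δ := by
    have h1 := hC.integral_deriv_min_gap δ z θ₁ (θ₁ + Real.pi)
    have h2 : ∫ θ in θ₁..(θ₁ + Real.pi), H θ
        ≤ ∫ θ in θ₁..(θ₁ + Real.pi), deriv (fun θ => min (gap C θ z) δ) θ := by
      refine intervalIntegral.integral_mono_ae_restrict (by linarith) (hint _ _) h1.1 ?_
      filter_upwards [ae_restrict_mem measurableSet_Icc,
        ae_restrict_of_ae (hC.ae_deriv_min_gap δ z), ae_restrict_of_ae hC.ae_differentiableAt_lowest,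
        ae_restrict_of_ae hne] with θ hθ h3 h4 h5
      rw [h3]
      have := hgap 1 θ (Or.inl rfl) (by
        rw [one_mul]
        exact Real.sin_pos_of_pos_of_lt_pi
          (by linarith [lt_of_le_of_ne hθ.1 (Ne.symm h5.1)])
          (by linarith [lt_of_le_of_ne hθ.2 h5.2])) h4
      rwa [one_mul] at this
    rw [h1.2, hθ₁, min_eq_left hδ.le] at h2
    linarith [min_le_right (gap C (θ₁ + Real.pi) z) δ]
  have hne' : ∀ᵐ θ : ℝ, θ ≠ θ₁ ∧ θ ≠ θ₁ - Real.pi := by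
    have : ∀ᵐ θ : ℝ, θ ∉ ({θ₁, θ₁ - Real.pi} : Set ℝ) :=
      measure_eq_zero_iff_ae_notMem.1 ((Set.toFinite _).measure_zero volume)
    filter_upwards [this] with θ h
    simpa using h
  have hleft : ∫ θ in (θ₁ - Real.pi)..θ₁, H θ ≤ δ := by
    have h1 := hC.integral_deriv_min_gap δ z (θ₁ - Real.pi) θ₁
    have h2 : ∫ θ in (θ₁ - Real.pi)..θ₁, H θ
        ≤ ∫ θ in (θ₁ - Real.pi)..θ₁, -deriv (fun θ => min (gap C θ z) δ) θ := by
      refine intervalIntegral.integral_mono_ae_restrict (by linarith) (hint _ _) h1.1.neg ?_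
      filter_upwards [ae_restrict_mem measurableSet_Icc,
        ae_restrict_of_ae (hC.ae_deriv_min_gap δ z), ae_restrict_of_ae hC.ae_differentiableAt_lowest,
        ae_restrict_of_ae hne'] with θ hθ h3 h4 h5
      rw [h3]
      have := hgap (-1) θ (Or.inr rfl) (by
        rw [neg_one_mul, neg_pos]
        exact Real.sin_neg_of_neg_of_neg_pi_lt
          (by linarith [lt_of_le_of_ne hθ.2 h5.1])
          (by linarith [lt_of_le_of_ne hθ.1 (Ne.symm h5.2)])) h4
      rwa [neg_one_mul] at this
    rw [intervalIntegral.integral_neg, h1.2, hθ₁, min_eq_left hδ.le] at h2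
    linarith [min_le_right (gap C (θ₁ - Real.pi) z) δ]
  -- Periodicity recentres the full turn at `θ₁`, wherever it lies relative to `α`.
  have htot : ∫ θ in α..(α + 2 * Real.pi), H θ ≤ 2 * δ := by
    rw [hHper.intervalIntegral_add_eq α (θ₁ - Real.pi),
      show θ₁ - Real.pi + 2 * Real.pi = θ₁ + Real.pi by ring,
      ← intervalIntegral.integral_add_adjacent_intervals (hint _ θ₁) (hint θ₁ _)]
    linarith
  rw [hH, intervalIntegral.integral_sub (hC.intervalIntegrable_slopeMass δ z _ _)
    ((hC.intervalIntegrable_nearIndicator δ z _ _).const_mul _),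
    intervalIntegral.integral_const_mul] at htot
  linarith

end IsCompactBody

/-! ### Integration over the boundary and the limit of small gaps. -/

/-- The boundary points whose gap is at most `δ` for some angle in `[α, β]`. -/
def someNear (C : Set Plane) (α β δ : ℝ) : Set Plane :=
  {z ∈ frontier C | ∃ θ ∈ Set.Icc α β, gap C θ z ≤ δ}

/-- The boundary points whose gap is at most `δ` for all angles in `[α, β]`. -/
def allNear (C : Set Plane) (α β δ : ℝ) : Set Plane :=
  {z ∈ frontier C | ∀ θ ∈ Set.Icc α β, gap C θ z ≤ δ}

/-- The pairs of an angle and a point with positive gap less than `δ`. -/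
def nearPairs (C : Set Plane) (δ : ℝ) : Set (ℝ × Plane) :=
  {p | 0 < gap C p.1 p.2 ∧ gap C p.1 p.2 < δ}

/-- The integral of `slopeMass` over an interval of angles and the boundary. -/
def totalMass (C : Set Plane) (α β δ : ℝ) : ℝ :=
  ∫ θ in α..β, ∫ z, slopeMass C δ θ z ∂(bdryMeasure C)

theorem tendsto_real_biInter_gt {X : Type*} [MeasurableSpace X] {μ : Measure X} [IsFiniteMeasure μ]
    {s : ℝ → Set X} {t : Set X} (hs : ∀ δ > 0, MeasurableSet (s δ))
    (hm : ∀ i j, 0 < i → i ≤ j → s i ⊆ s j) (ht : ⋂ δ > 0, s δ = t) :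
    Tendsto (fun δ => μ.real (s δ)) (𝓝[>] (0 : ℝ)) (𝓝 (μ.real t)) := by
  have := tendsto_measure_biInter_gt (μ := μ) (a := (0 : ℝ)) (s := s)
    (fun r hr => (hs r hr).nullMeasurableSet) hm ⟨1, one_pos, measure_ne_top _ _⟩
  rw [ht] at this
  exact (ENNReal.tendsto_toReal (measure_ne_top μ t)).comp this

theorem nearIndicator_nonneg (C : Set Plane) (δ : ℝ) (z : Plane) (θ : ℝ) :
    0 ≤ nearIndicator C δ z θ := Set.indicator_nonneg (fun _ _ => zero_le_one) θ

namespace IsCompactBody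

variable {C : Set Plane} (hC : IsCompactBody C)
include hC

theorem isCompact_frontier : IsCompact (frontier C) :=
  hC.compact.of_isClosed_subset isClosed_frontier hC.frontier_subset

theorem isClosed_someNear (α β δ : ℝ) : IsClosed (someNear C α β δ) := by
  have hK : IsCompact ((Set.Icc α β ×ˢ frontier C) ∩ {p : ℝ × Plane | gap C p.1 p.2 ≤ δ}) :=
    (isCompact_Icc.prod hC.isCompact_frontier).inter_right
      (isClosed_Iic.preimage hC.continuous_gap_uncurry)
  have : someNear C α β δ
      = Prod.snd '' ((Set.Icc α β ×ˢ frontier C) ∩ {p : ℝ × Plane | gap C p.1 p.2 ≤ δ}) := by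
    ext z
    constructor
    · rintro ⟨hz, θ, hθ, hg⟩
      exact ⟨(θ, z), ⟨⟨hθ, hz⟩, hg⟩, rfl⟩
    · rintro ⟨⟨θ, z⟩, ⟨⟨hθ, hz⟩, hg⟩, rfl⟩
      exact ⟨hz, θ, hθ, hg⟩
  rw [this]
  exact (hK.image continuous_snd).isClosed

theorem isClosed_allNear (α β δ : ℝ) : IsClosed (allNear C α β δ) := by
  have : allNear C α β δ
      = frontier C ∩ ⋂ θ ∈ Set.Icc α β, {z | gap C θ z ≤ δ} := by
    ext z; simp [allNear]
  rw [this]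
  refine isClosed_frontier.inter (isClosed_biInter fun θ _ => ?_)
  exact isClosed_Iic.preimage (hC.continuous_gap_uncurry.comp (Continuous.prodMk_right θ))

theorem iInter_someNear (α β : ℝ) : ⋂ δ > 0, someNear C α β δ = someNear C α β 0 := by
  ext z
  simp only [Set.mem_iInter]
  constructor
  · intro h
    obtain ⟨hz, θ₁, hθ₁, _⟩ := h 1 one_pos
    obtain ⟨θ, hθ, hmin⟩ := (isCompact_Icc (a := α) (b := β)).exists_isMinOn ⟨θ₁, hθ₁⟩
      (hC.continuous_gap z).continuousOn
    refine ⟨hz, θ, hθ, le_of_forall_pos_le_add fun ε hε => ?_⟩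
    obtain ⟨_, θ', hθ', hg⟩ := h ε hε
    rw [zero_add]
    exact (hmin hθ').trans hg
  · rintro ⟨hz, θ, hθ, hg⟩ δ hδ
    exact ⟨hz, θ, hθ, hg.trans (le_of_lt hδ)⟩

theorem tendsto_someNear (α β : ℝ) : Tendsto (fun δ => (bdryMeasure C).real (someNear C α β δ))
    (𝓝[>] (0 : ℝ)) (𝓝 ((bdryMeasure C).real (someNear C α β 0))) := by
  have := hC.isFiniteMeasure_bdryMeasure
  refine tendsto_real_biInter_gt (fun δ _ => (hC.isClosed_someNear α β δ).measurableSet) ?_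
    (hC.iInter_someNear α β)
  rintro i j _ hij z ⟨hz, θ, hθ, hg⟩
  exact ⟨hz, θ, hθ, hg.trans hij⟩

/-- Two independent support lines pass through such a point and determine it. -/
theorem allNear_zero_subsingleton {α β : ℝ} (hαβ : α < β) : (allNear C α β 0).Subsingleton := by
  intro z hz w hw
  have heq : ∀ θ ∈ Set.Icc α β, height θ (z - w) = 0 := by
    intro θ hθ
    have h1 := le_antisymm (hz.2 θ hθ) (hC.gap_nonneg θ (hC.frontier_subset hz.1))
    have h2 := le_antisymm (hw.2 θ hθ) (hC.gap_nonneg θ (hC.frontier_subset hw.1))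
    unfold gap at h1 h2
    rw [height_sub]; linarith
  -- Truncation at 1 keeps `sin η` positive even when `β - α` is `π` or `2π`.
  set η := min (β - α) 1
  have hη : 0 < η := lt_min (by linarith) one_pos
  have h1 := heq α ⟨le_rfl, hαβ.le⟩
  have h2 := heq (α + η) ⟨by linarith, by linarith [min_le_left (β - α) 1]⟩
  rw [height_add_angle, h1, mul_zero, zero_add] at h2
  have h3 : Real.sin η ≠ 0 := (Real.sin_pos_of_pos_of_lt_pi hη
    (lt_of_le_of_lt (min_le_right _ _) (by linarith [Real.pi_gt_three]))).ne'
  have h4 := (mul_eq_zero.1 h2).resolve_left h3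
  have h5 := norm_sq_eq_height_tang α (z - w)
  rw [h1, h4] at h5
  have h6 : ‖z - w‖ = 0 := by
    rw [← sq_eq_zero_iff, h5]; ring
  exact sub_eq_zero.1 (norm_eq_zero.1 h6)

theorem tendsto_allNear {α β : ℝ} (hαβ : α < β) :
    Tendsto (fun δ => (bdryMeasure C).real (allNear C α β δ)) (𝓝[>] (0 : ℝ)) (𝓝 0) := by
  have := hC.isFiniteMeasure_bdryMeasure
  have h0 : (bdryMeasure C).real (allNear C α β 0) = 0 := by
    rcases (hC.allNear_zero_subsingleton hαβ).eq_empty_or_singleton with h | ⟨x, h⟩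
    · rw [h, measureReal_empty]
    · have hx : (μH[1] : Measure Plane) {x} = 0 := by
        have := Measure.nullSingletonClass_hausdorff Plane (d := 1) one_pos
        exact measure_singleton x
      have hx' : bdryMeasure C {x} = 0 :=
        le_antisymm ((Measure.restrict_apply_le _ _).trans hx.le) bot_le
      rw [h, measureReal_def, hx', ENNReal.toReal_zero]
  suffices h : Tendsto (fun δ => (bdryMeasure C).real (allNear C α β δ)) (𝓝[>] (0 : ℝ))
      (𝓝 ((bdryMeasure C).real (allNear C α β 0))) by rwa [h0] at h
  refine tendsto_real_biInter_gt (μ := bdryMeasure C) (fun δ _ => (hC.isClosed_allNear α β δ).measurableSet) ?_ ?_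
  · rintro i j _ hij z ⟨hz, h⟩
    exact ⟨hz, fun θ hθ => (h θ hθ).trans hij⟩
  · ext z
    simp only [Set.mem_iInter]
    constructor
    · intro h
      refine ⟨(h 1 one_pos).1, fun θ hθ => le_of_forall_pos_le_add fun ε hε => ?_⟩
      rw [zero_add]
      exact (h ε hε).2 θ hθ
    · rintro ⟨hz, h⟩ δ hδ
      exact ⟨hz, fun θ hθ => (h θ hθ).trans (le_of_lt hδ)⟩

theorem measurableSet_nearPairs (δ : ℝ) : MeasurableSet (nearPairs C δ) :=
  ((isOpen_Ioi.inter isOpen_Iio).preimage hC.continuous_gap_uncurry).measurableSet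

/-- The pairs with gap exactly zero are excluded, so these sets decrease to the empty set. This
makes the monotonicity error `o(δ)`. -/
theorem tendsto_nearPairs (α : ℝ) :
    Tendsto (fun δ => ((volume.restrict (Set.Ioc α (α + 2 * Real.pi))).prod (bdryMeasure C)).real
      (nearPairs C δ)) (𝓝[>] (0 : ℝ)) (𝓝 0) := by
  have := hC.isFiniteMeasure_bdryMeasure
  set ν := (volume.restrict (Set.Ioc α (α + 2 * Real.pi))).prod (bdryMeasure C)
  suffices h : Tendsto (fun δ => ν.real (nearPairs C δ)) (𝓝[>] (0 : ℝ)) (𝓝 (ν.real ∅)) by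
    rwa [measureReal_empty] at h
  refine tendsto_real_biInter_gt
    (μ := ν) (fun δ _ => hC.measurableSet_nearPairs δ) ?_ ?_
  · rintro i j _ hij p ⟨h1, h2⟩
    exact ⟨h1, h2.trans_le hij⟩
  · ext p
    simp only [Set.mem_iInter, Set.mem_empty_iff_false, iff_false, not_forall]
    by_cases h : 0 < gap C p.1 p.2
    · exact ⟨_, h, fun h' => lt_irrefl _ h'.2⟩
    · exact ⟨1, one_pos, fun h' => h h'.1⟩

theorem integral_nearIndicator (α δ : ℝ) :
    Integrable (fun z => ∫ θ in α..(α + 2 * Real.pi), nearIndicator C δ z θ) (bdryMeasure C) ∧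
    ∫ z, (∫ θ in α..(α + 2 * Real.pi), nearIndicator C δ z θ) ∂(bdryMeasure C)
      = ((volume.restrict (Set.Ioc α (α + 2 * Real.pi))).prod (bdryMeasure C)).real
        (nearPairs C δ) := by
  have := hC.isFiniteMeasure_bdryMeasure
  have hm := hC.measurableSet_nearPairs δ
  have hi : Integrable (fun p : ℝ × Plane => nearIndicator C δ p.2 p.1)
      ((volume.restrict (Set.Ioc α (α + 2 * Real.pi))).prod (bdryMeasure C)) :=
    (integrable_const (1 : ℝ)).indicator hm
  have hle : α ≤ α + 2 * Real.pi := by linarith [Real.pi_pos]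
  simp only [intervalIntegral.integral_of_le hle]
  refine ⟨hi.integral_prod_right, ?_⟩
  rw [← integral_prod_symm _ hi, ← integral_indicator_one hm]
  rfl

theorem totalMass_eq {α β : ℝ} (hαβ : α ≤ β) (δ : ℝ) :
    Integrable (fun z => ∫ θ in α..β, slopeMass C δ θ z) (bdryMeasure C) ∧
    totalMass C α β δ = ∫ z, (∫ θ in α..β, slopeMass C δ θ z) ∂(bdryMeasure C) := by
  have := hC.isFiniteMeasure_bdryMeasure
  have hi := hC.integrable_slopeMass_uncurry δ (volume.restrict (Set.Ioc α β))
  unfold totalMass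
  simp only [intervalIntegral.integral_of_le hαβ]
  exact ⟨hi.integral_prod_right, integral_integral_swap hi⟩

/-- A point with a normal in the interval contributes `δ` unless its gap stays at most `δ`
throughout. Such exceptional points shrink to at most one vertex, of zero length. -/
theorem le_totalMass {α β δ : ℝ} (hαβ : α ≤ β) (hδ : 0 < δ) :
    δ * ((bdryMeasure C).real (someNear C α β 0) - (bdryMeasure C).real (allNear C α β δ))
      ≤ totalMass C α β δ := by
  have := hC.isFiniteMeasure_bdryMeasure
  obtain ⟨hi, he⟩ := hC.totalMass_eq hαβ δ
  have hm1 := (hC.isClosed_someNear α β 0).measurableSet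
  have hm2 := (hC.isClosed_allNear α β δ).measurableSet
  have hm := hm1.diff hm2
  rw [he]
  calc _ ≤ δ * (bdryMeasure C).real (someNear C α β 0 \ allNear C α β δ) := by
        have := le_measureReal_sdiff (μ := bdryMeasure C) (s₁ := someNear C α β 0)
          (s₂ := allNear C α β δ)
        gcongr
    _ = ∫ z, (someNear C α β 0 \ allNear C α β δ).indicator (fun _ => δ) z ∂(bdryMeasure C) := by
        rw [integral_indicator hm, setIntegral_const, smul_eq_mul, mul_comm]
    _ ≤ _ := by
        refine integral_mono ((integrable_const δ).indicator hm) hi fun z => ?_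
        refine Set.indicator_le' (g := fun z => ∫ θ in α..β, slopeMass C δ θ z)
          (fun z hz => ?_) (fun z _ => ?_) z
        · obtain ⟨⟨hz1, θ₀, hθ₀, hg₀⟩, hz2⟩ := hz
          have hg0 := le_antisymm hg₀ (hC.gap_nonneg θ₀ (hC.frontier_subset hz1))
          have : ∃ θ ∈ Set.Icc α β, δ < gap C θ z := by
            by_contra hcon
            push Not at hcon
            exact hz2 ⟨hz1, hcon⟩
          obtain ⟨θ₁, hθ₁, hg₁⟩ := this
          exact hC.le_integral_slopeMass hδ.le hθ₀ hθ₁ hg0 hg₁.le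
        · exact intervalIntegral.integral_nonneg hαβ fun θ _ => slopeMass_nonneg _ _ _ _

/-- Points outside `someNear` contribute nothing. For the others the interval is enlarged to a full
turn, where the bound `2δ` plus error is available. -/
theorem totalMass_le {c : Plane} {r D : ℝ} (hr : 0 < r)
    (hcr : Metric.closedBall c r ⊆ C) (hD : ∀ x ∈ C, ∀ y ∈ C, dist x y ≤ D) {α β δ : ℝ}
    (hαβ : α ≤ β) (hβ : β ≤ α + 2 * Real.pi) (hδ : 0 < δ) (hδr : δ ≤ r / 2) :
    totalMass C α β δ ≤ δ * (2 * (bdryMeasure C).real (someNear C α β δ)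
      + 2 * (2 * D / r) * ((volume.restrict (Set.Ioc α (α + 2 * Real.pi))).prod
        (bdryMeasure C)).real (nearPairs C δ)) := by
  have := hC.isFiniteMeasure_bdryMeasure
  obtain ⟨hi, he⟩ := hC.totalMass_eq hαβ δ
  obtain ⟨hni, hne⟩ := hC.integral_nearIndicator α δ
  have hm1 := (hC.isClosed_someNear α β δ).measurableSet
  set N := fun z => ∫ θ in α..(α + 2 * Real.pi), nearIndicator C δ z θ with hN
  set M := 2 * (2 * D / r) with hM
  have hD0 : 0 ≤ D := by
    obtain ⟨z, hz⟩ := hC.nonempty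
    exact dist_nonneg.trans (hD z hz z hz)
  have hM0 : 0 ≤ M := by positivity
  have hle : α ≤ α + 2 * Real.pi := by linarith [Real.pi_pos]
  have hN0 : ∀ z, 0 ≤ N z := fun z => intervalIntegral.integral_nonneg hle fun θ _ =>
    nearIndicator_nonneg C δ z θ
  have hind : Integrable ((someNear C α β δ).indicator fun _ => 2 * δ) (bdryMeasure C) :=
    (integrable_const _).indicator hm1
  have hpt : ∀ᵐ z ∂(bdryMeasure C), ∫ θ in α..β, slopeMass C δ θ z
      ≤ (someNear C α β δ).indicator (fun _ => 2 * δ) z + M * δ * N z := by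
    filter_upwards [ae_mem_frontier C] with z hz
    have hMN : 0 ≤ M * δ * N z := mul_nonneg (mul_nonneg hM0 hδ.le) (hN0 z)
    by_cases h : z ∈ someNear C α β δ
    · rw [Set.indicator_of_mem h]
      refine le_trans ?_ (hC.integral_slopeMass_le_of_mem_frontier hr hcr hD hz hδ hδr α)
      exact intervalIntegral.integral_mono_interval le_rfl hαβ hβ
        (ae_of_all _ fun θ => slopeMass_nonneg _ _ _ _) (hC.intervalIntegrable_slopeMass δ z _ _)
    · rw [Set.indicator_of_notMem h, zero_add]
      refine le_trans (le_of_eq ?_) hMN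
      have h0 : Set.EqOn (fun θ => slopeMass C δ θ z) (fun _ => 0) (Set.uIcc α β) := by
        intro θ hθ
        rw [Set.uIcc_of_le hαβ] at hθ
        have hn : z ∉ {w | gap C θ w < δ} := fun hlt => h ⟨hz, θ, hθ, le_of_lt hlt⟩
        exact Set.indicator_of_notMem hn _
      rw [intervalIntegral.integral_congr h0, intervalIntegral.integral_zero]
  rw [he]
  calc _ ≤ ∫ z, ((someNear C α β δ).indicator (fun _ => 2 * δ) z + M * δ * N z) ∂(bdryMeasure C) :=
        integral_mono_ae hi (hind.add (hni.const_mul _)) hpt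
    _ = _ := by
        rw [integral_add hind (hni.const_mul _), integral_const_mul, hne,
          integral_indicator hm1, setIntegral_const, smul_eq_mul]
        ring

/-- The total mass is comparable to the portion of the perimeter, asymptotically. -/
theorem totalMass_asymptotic {α β : ℝ} (hαβ : α < β) (hβ : β ≤ α + 2 * Real.pi) :
    ∃ ε : ℝ → ℝ, Tendsto ε (𝓝[>] (0 : ℝ)) (𝓝 0) ∧ ∀ᶠ δ in 𝓝[>] (0 : ℝ),
      δ * ((bdryMeasure C).real (someNear C α β 0) - ε δ) ≤ totalMass C α β δ ∧
      totalMass C α β δ ≤ δ * (2 * (bdryMeasure C).real (someNear C α β 0) + ε δ) := by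
  obtain ⟨c, r, hr, hcr⟩ := hC.exists_ball
  obtain ⟨D, hD⟩ := Metric.isBounded_iff.1 hC.compact.isBounded
  have hD' : ∀ x ∈ C, ∀ y ∈ C, dist x y ≤ D := fun x hx y hy => hD hx hy
  have hD0 : 0 ≤ D := by
    obtain ⟨z, hz⟩ := hC.nonempty
    exact dist_nonneg.trans (hD' z hz z hz)
  have := hC.isFiniteMeasure_bdryMeasure
  set P := (bdryMeasure C).real (someNear C α β 0) with hP
  set M := 2 * (2 * D / r) with hM
  have hM0 : 0 ≤ M := by positivity
  have t1 := hC.tendsto_allNear hαβ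
  have t2 := hC.tendsto_someNear α β
  have t3 := hC.tendsto_nearPairs α
  set f1 := fun δ => (bdryMeasure C).real (allNear C α β δ)
  set f2 := fun δ => (bdryMeasure C).real (someNear C α β δ)
  set f3 := fun δ => ((volume.restrict (Set.Ioc α (α + 2 * Real.pi))).prod (bdryMeasure C)).real
      (nearPairs C δ)
  -- The three nonnegative errors are added so that one function serves both bounds.
  refine ⟨fun δ => f1 δ + 2 * (f2 δ - P) + M * f3 δ, ?_, ?_⟩
  · have := (t1.add ((t2.sub_const P).const_mul 2)).add (t3.const_mul M)
    simpa [hP] using this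
  · have hev : ∀ᶠ δ in 𝓝[>] (0 : ℝ), δ ∈ Set.Ioc 0 (r / 2) := Ioc_mem_nhdsGT (by linarith)
    filter_upwards [hev] with δ hδ
    have n1 : 0 ≤ f1 δ := measureReal_nonneg
    have n3 : 0 ≤ f3 δ := measureReal_nonneg
    have n2 : P ≤ f2 δ := measureReal_mono (by
      rintro z ⟨hz, θ, hθ, hg⟩
      exact ⟨hz, θ, hθ, hg.trans hδ.1.le⟩)
    have l1 := hC.le_totalMass hαβ.le hδ.1
    have l2 := hC.totalMass_le hr hcr hD' hαβ.le hβ hδ.1 hδ.2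
    have n4 := mul_nonneg hM0 n3
    constructor
    · refine le_trans (mul_le_mul_of_nonneg_left ?_ hδ.1.le) l1
      change P - (f1 δ + 2 * (f2 δ - P) + M * f3 δ) ≤ P - f1 δ
      linarith
    · refine l2.trans (mul_le_mul_of_nonneg_left ?_ hδ.1.le)
      change 2 * f2 δ + M * f3 δ ≤ 2 * P + (f1 δ + 2 * (f2 δ - P) + M * f3 δ)
      linarith

end IsCompactBody

/-! ### Perimeter portions and the final estimates for compact bodies. -/

theorem mem_normals_iff {C : Set Plane} (hC : IsCompactBody C) (x : Plane) (θ : ℝ) :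
    (θ : Real.Angle) ∈ normals C x ↔ gap C θ x = 0 := by
  have himg : (fun a : Plane => inner ℝ a (unitVec (θ : Real.Angle))) '' C = height θ '' C :=
    Set.image_congr fun a _ => inner_unitVec θ a
  have hglb : IsGLB (height θ '' C) (lowest C θ) :=
    isGLB_csInf (hC.nonempty.image _) (hC.compact_image θ).bddBelow
  unfold normals gap
  rw [Set.mem_ofPred_eq, himg, inner_unitVec, sub_eq_zero]
  exact ⟨fun h => h.unique hglb, fun h => h ▸ hglb⟩

theorem perimeterPortion_eq {C : Set Plane} (hC : IsCompactBody C) (α β : ℝ) :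
    perimeterPortion C (angleIcc α β) = (bdryMeasure C).real (someNear C α β 0) := by
  have hset : {x ∈ frontier C | (normals C x ∩ angleIcc α β).Nonempty} = someNear C α β 0 := by
    ext x
    constructor
    · rintro ⟨hx, _, hn, ⟨θ, hθ, rfl⟩⟩
      exact ⟨hx, θ, hθ, ((mem_normals_iff hC x θ).1 hn).le⟩
    · rintro ⟨hx, θ, hθ, hg⟩
      exact ⟨hx, (θ : Real.Angle), (mem_normals_iff hC x θ).2
        (le_antisymm hg (hC.gap_nonneg θ (hC.frontier_subset hx))), θ, hθ, rfl⟩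
  unfold perimeterPortion bdryMeasure
  rw [hset, measureReal_restrict_apply (hC.isClosed_someNear α β 0).measurableSet,
    Set.inter_eq_left.2 fun x hx => hx.1]

theorem angleIcc_add_pi (α β : ℝ) :
    (fun θ : Real.Angle => θ + (Real.pi : Real.Angle)) '' angleIcc α β
      = angleIcc (α + Real.pi) (β + Real.pi) := by
  unfold angleIcc
  rw [Set.image_image, ← Set.image_add_const_Icc, Set.image_image]
  rfl

namespace IsCompactBody

variable {C : Set Plane} (hC : IsCompactBody C)
include hC

theorem integrableOn_mass (α β δ : ℝ) :
    IntervalIntegrable (fun θ => ∫ z, slopeMass C δ θ z ∂(bdryMeasure C)) volume α β := by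
  have := hC.isFiniteMeasure_bdryMeasure
  rw [intervalIntegrable_iff]
  have : IsFiniteMeasure ((volume : Measure ℝ).restrict (Set.uIoc α β)) :=
    ⟨by rw [Measure.restrict_apply_univ]; simp⟩
  exact (hC.integrable_slopeMass_uncurry δ (volume.restrict (Set.uIoc α β))).integral_prod_left

theorem integral_mass_add (α β δ : ℝ) :
    ∫ θ in α..β, ((∫ z, slopeMass C δ θ z ∂(bdryMeasure C))
      + ∫ z, slopeMass C δ (θ + Real.pi) z ∂(bdryMeasure C))
      = totalMass C α β δ + totalMass C (α + Real.pi) (β + Real.pi) δ := by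
  have h1 := hC.integrableOn_mass α β δ
  have h2 : IntervalIntegrable
      (fun θ => ∫ z, slopeMass C δ (θ + Real.pi) z ∂(bdryMeasure C)) volume α β := by
    have := (hC.integrableOn_mass (α + Real.pi) (β + Real.pi) δ).comp_add_right Real.pi
    simpa using this
  rw [intervalIntegral.integral_add h1 h2]
  congr 1
  exact intervalIntegral.integral_comp_add_right
    (fun θ => ∫ z, slopeMass C δ θ z ∂(bdryMeasure C)) Real.pi

theorem intervalIntegrable_mass_add (α β δ : ℝ) : IntervalIntegrable
    (fun θ => (∫ z, slopeMass C δ θ z ∂(bdryMeasure C))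
      + ∫ z, slopeMass C δ (θ + Real.pi) z ∂(bdryMeasure C)) volume α β := by
  have := (hC.integrableOn_mass (α + Real.pi) (β + Real.pi) δ).comp_add_right Real.pi
  rw [add_sub_cancel_right, add_sub_cancel_right] at this
  exact (hC.integrableOn_mass α β δ).add this

theorem fourierAverage_le {α β : ℝ} (hαβ : α ≤ β) : ∀ᶠ ρ : ℝ in atTop,
    fourierAverage C α β ρ ≤ 48 * ρ⁻¹ ^ 2 *
      (totalMass C α β ρ⁻¹ + totalMass C (α + Real.pi) (β + Real.pi) ρ⁻¹) := by
  obtain ⟨c, r, hr, hcr⟩ := hC.exists_ball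
  filter_upwards [eventually_gt_atTop 0, eventually_ge_atTop (1 / r)] with ρ hρ hρr
  rw [hC.fourierAverage_eq, ← hC.integral_mass_add,
    ← intervalIntegral.integral_const_mul]
  refine intervalIntegral.integral_mono_on hαβ
    ((hC.continuous_dilationAverage ρ).intervalIntegrable _ _)
    ((hC.intervalIntegrable_mass_add α β ρ⁻¹).const_mul _) fun θ _ => ?_
  have hw := hC.two_mul_le_width hr hcr θ
  have h1 := (hC.chord_isConcaveProfile θ).average_le hρ (by
    rw [div_le_iff₀ hr] at hρr; nlinarith)
  rw [hC.endSum_chord] at h1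
  -- The chord at depth `1/(2ρ)` from `average_le` lies strictly below the cutoff `1/ρ`, as
  -- `chord_sq_le` requires. The constant is `48 = 3 · 2 · 8`.
  have hlt : 1 / (2 * ρ) < ρ⁻¹ := by
    rw [one_div, mul_inv]
    have := inv_pos.2 hρ
    linarith
  have k1 := hC.chord_sq_le θ hlt
  have k2 := hC.chord_sq_le (θ + Real.pi) hlt
  set a := chord C θ (lowest C θ + 1 / (2 * ρ))
  set b := chord C (θ + Real.pi) (lowest C (θ + Real.pi) + 1 / (2 * ρ))
  refine h1.trans ?_
  have h2 : (a + b) ^ 2 ≤ 2 * (a ^ 2 + b ^ 2) := by nlinarith [sq_nonneg (a - b)]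
  calc 3 * ρ⁻¹ ^ 2 * (a + b) ^ 2 ≤ 3 * ρ⁻¹ ^ 2 * (16 * ((∫ z, slopeMass C ρ⁻¹ θ z ∂(bdryMeasure C))
      + ∫ z, slopeMass C ρ⁻¹ (θ + Real.pi) z ∂(bdryMeasure C))) := by gcongr; linarith
    _ = _ := by ring

/-- The second-order error in `integral_slopeMass_le` becomes `Q * ρ⁻¹ ^ 2`, negligible against a
total mass of order `ρ⁻¹`. -/
theorem le_fourierAverage {α β : ℝ} (hαβ : α ≤ β) {c₀ K : ℝ} (hc₀ : 0 < c₀)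
    (hlow : ∀ (f : ℝ → ℝ) (a b ρ : ℝ), IsConcaveProfile f a b → 0 < ρ → K ≤ ρ * (b - a) →
      c₀ * ρ⁻¹ ^ 2 * endSum f a b (1 / ρ) ^ 2
        ≤ ∫ δ in (0 : ℝ)..1, δ ^ 4 * spectralEnergy f (ρ * δ)) :
    ∃ Q : ℝ, ∀ᶠ ρ : ℝ in atTop,
      c₀ / 10 * ρ⁻¹ ^ 2 *
        (totalMass C α β ρ⁻¹ + totalMass C (α + Real.pi) (β + Real.pi) ρ⁻¹ - Q * ρ⁻¹ ^ 2)
      ≤ fourierAverage C α β ρ := by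
  obtain ⟨c, r, hr, hcr⟩ := hC.exists_ball
  obtain ⟨D, hD⟩ := Metric.isBounded_iff.1 hC.compact.isBounded
  have hD' : ∀ x ∈ C, ∀ y ∈ C, dist x y ≤ D := fun x hx y hy => hD hx hy
  set q := 10 * (2 * D / r) ^ 2 + 1 with hq
  have hq0 : 0 ≤ q := by positivity
  refine ⟨(β - α) * (2 * q), ?_⟩
  filter_upwards [eventually_gt_atTop 0, eventually_ge_atTop (1 / r),
    eventually_ge_atTop (K / (2 * r))] with ρ hρ hρr hρK
  have hδ : 0 < ρ⁻¹ := inv_pos.2 hρ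
  have hδr : ρ⁻¹ ≤ r := by
    rw [inv_le_comm₀ hρ hr, ← one_div]; exact hρr
  have hint := hC.intervalIntegrable_mass_add α β ρ⁻¹
  have e : c₀ / 10 * ρ⁻¹ ^ 2 *
        (totalMass C α β ρ⁻¹ + totalMass C (α + Real.pi) (β + Real.pi) ρ⁻¹
          - (β - α) * (2 * q) * ρ⁻¹ ^ 2)
      = ∫ θ in α..β, c₀ / 10 * ρ⁻¹ ^ 2 * (((∫ z, slopeMass C ρ⁻¹ θ z ∂(bdryMeasure C))
        + ∫ z, slopeMass C ρ⁻¹ (θ + Real.pi) z ∂(bdryMeasure C)) - 2 * q * ρ⁻¹ ^ 2) := by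
    rw [intervalIntegral.integral_const_mul, intervalIntegral.integral_sub hint (by simp),
      hC.integral_mass_add, intervalIntegral.integral_const, smul_eq_mul]
    ring
  rw [hC.fourierAverage_eq, e]
  have hd1 := hC.ae_differentiableAt_lowest
  have hd2 : ∀ᵐ θ : ℝ, DifferentiableAt ℝ (lowest C) (θ + Real.pi) :=
    (measurePreserving_add_right volume Real.pi).quasiMeasurePreserving.ae hd1
  refine intervalIntegral.integral_mono_ae hαβ ((hint.sub (by simp)).const_mul _)
    ((hC.continuous_dilationAverage ρ).intervalIntegrable _ _) ?_
  filter_upwards [hd1, hd2] with θ h1 h2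
  have hw := hC.two_mul_le_width hr hcr θ
  have hl := hlow _ _ _ ρ (hC.chord_isConcaveProfile θ) hρ (by
    rw [div_le_iff₀ (by linarith)] at hρK; nlinarith)
  rw [hC.endSum_chord, one_div] at hl
  have k1 := hC.integral_slopeMass_le hr hcr hD' hδ hδr h1
  have k2 := hC.integral_slopeMass_le hr hcr hD' hδ hδr h2
  have n1 : 0 ≤ chord C θ (lowest C θ + ρ⁻¹) := measureReal_nonneg
  have n2 : 0 ≤ chord C (θ + Real.pi) (lowest C (θ + Real.pi) + ρ⁻¹) := measureReal_nonneg
  set a := chord C θ (lowest C θ + ρ⁻¹)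
  set b := chord C (θ + Real.pi) (lowest C (θ + Real.pi) + ρ⁻¹)
  refine le_trans ?_ hl
  have h3 : a ^ 2 + b ^ 2 ≤ (a + b) ^ 2 := by nlinarith
  calc _ ≤ c₀ / 10 * ρ⁻¹ ^ 2 * (10 * (a + b) ^ 2) := by gcongr; rw [← hq] at k1 k2; linarith
    _ = _ := by ring

/-- For large `ρ` the errors are below `P` in the upper bound and `P/2` in the lower, giving `144 =
48 · (2 + 1)` and `c₀/20`. How large `ρ` must be depends on the body and the interval; the constants
do not. -/
theorem asymptotic_bounds {c₀ K : ℝ} (hc₀ : 0 < c₀)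
    (hlow : ∀ (f : ℝ → ℝ) (a b ρ : ℝ), IsConcaveProfile f a b → 0 < ρ → K ≤ ρ * (b - a) →
      c₀ * ρ⁻¹ ^ 2 * endSum f a b (1 / ρ) ^ 2
        ≤ ∫ δ in (0 : ℝ)..1, δ ^ 4 * spectralEnergy f (ρ * δ))
    {α β : ℝ} (hαβ : α < β) (hβ : β ≤ α + 2 * Real.pi) {P : ℝ}
    (hP : P = perimeterPortion C (angleIcc α β)
      + perimeterPortion C (angleIcc (α + Real.pi) (β + Real.pi))) :
    (P ≠ 0 → ∀ᶠ ρ : ℝ in atTop,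
      c₀ / 20 * (ρ⁻¹ ^ 3 * P) ≤ fourierAverage C α β ρ ∧
      fourierAverage C α β ρ ≤ 144 * (ρ⁻¹ ^ 3 * P)) ∧
    (P = 0 → Tendsto (fun ρ : ℝ => ρ ^ 3 * fourierAverage C α β ρ) atTop (𝓝 0)) := by
  rw [perimeterPortion_eq hC, perimeterPortion_eq hC] at hP
  obtain ⟨ε₁, hε₁, hb₁⟩ := hC.totalMass_asymptotic hαβ hβ
  obtain ⟨ε₂, hε₂, hb₂⟩ := hC.totalMass_asymptotic (α := α + Real.pi) (β := β + Real.pi)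
    (by linarith) (by linarith)
  obtain ⟨Q, hQ⟩ := hC.le_fourierAverage hαβ.le hc₀ hlow
  have hup := hC.fourierAverage_le hαβ.le
  set P₁ := (bdryMeasure C).real (someNear C α β 0)
  set P₂ := (bdryMeasure C).real (someNear C (α + Real.pi) (β + Real.pi) 0)
  have hP0 : 0 ≤ P := by rw [hP]; exact add_nonneg measureReal_nonneg measureReal_nonneg
  have hinv := tendsto_inv_atTop_nhdsGT_zero (𝕜 := ℝ)
  have hinv0 : Tendsto (fun ρ : ℝ => ρ⁻¹) atTop (𝓝 0) := tendsto_inv_atTop_zero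
  set η : ℝ → ℝ := fun ρ => ε₁ ρ⁻¹ + ε₂ ρ⁻¹ with hη
  have hη0 : Tendsto η atTop (𝓝 0) := by
    have := (hε₁.comp hinv).add (hε₂.comp hinv)
    simpa using this
  have hη1 : Tendsto (fun ρ => η ρ + Q * ρ⁻¹) atTop (𝓝 0) := by
    simpa using hη0.add (hinv0.const_mul Q)
  have U : ∀ᶠ ρ : ℝ in atTop, fourierAverage C α β ρ ≤ 48 * ρ⁻¹ ^ 3 * (2 * P + η ρ) := by
    filter_upwards [hup, hinv.eventually hb₁, hinv.eventually hb₂, eventually_gt_atTop 0]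
      with ρ h h₁ h₂ hρ
    refine h.trans ?_
    calc _ ≤ 48 * ρ⁻¹ ^ 2 * (ρ⁻¹ * (2 * P₁ + ε₁ ρ⁻¹) + ρ⁻¹ * (2 * P₂ + ε₂ ρ⁻¹)) := by
          gcongr
          · exact h₁.2
          · exact h₂.2
      _ = _ := by rw [hP, hη]; ring
  refine ⟨fun hne => ?_, fun h0 => ?_⟩
  · have hpos : 0 < P := lt_of_le_of_ne hP0 (Ne.symm hne)
    filter_upwards [U, hQ, hinv.eventually hb₁, hinv.eventually hb₂, eventually_gt_atTop 0,
      hη0.eventually (gt_mem_nhds hpos),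
      hη1.eventually (gt_mem_nhds (show 0 < P / 2 by linarith))] with ρ h h' h₁ h₂ hρ h₃ h₄
    constructor
    · refine le_trans ?_ h'
      calc c₀ / 20 * (ρ⁻¹ ^ 3 * P) = c₀ / 10 * ρ⁻¹ ^ 2 * (ρ⁻¹ * (P / 2)) := by ring
        _ ≤ c₀ / 10 * ρ⁻¹ ^ 2 * (ρ⁻¹ * (P - (η ρ + Q * ρ⁻¹))) := by gcongr; linarith
        _ = c₀ / 10 * ρ⁻¹ ^ 2 * (ρ⁻¹ * (P₁ - ε₁ ρ⁻¹) + ρ⁻¹ * (P₂ - ε₂ ρ⁻¹) - Q * ρ⁻¹ ^ 2) := by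
            rw [hP, hη]; ring
        _ ≤ _ := by
            gcongr
            · exact h₁.1
            · exact h₂.1
    · refine h.trans ?_
      calc _ ≤ 48 * ρ⁻¹ ^ 3 * (3 * P) := by gcongr; linarith
        _ = _ := by ring
  · have hlim : Tendsto (fun ρ => 48 * η ρ) atTop (𝓝 0) := by simpa using hη0.const_mul 48
    refine squeeze_zero' ?_ ?_ hlim
    · filter_upwards [eventually_gt_atTop 0] with ρ hρ
      refine mul_nonneg (by positivity) ?_
      exact intervalIntegral.integral_nonneg hαβ.le fun θ _ =>
        intervalIntegral.integral_nonneg zero_le_one fun δ _ => sq_nonneg _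
    · filter_upwards [U, eventually_gt_atTop 0] with ρ h hρ
      calc ρ ^ 3 * fourierAverage C α β ρ ≤ ρ ^ 3 * (48 * ρ⁻¹ ^ 3 * (2 * P + η ρ)) := by gcongr
        _ = 48 * η ρ := by rw [h0]; field_simp; ring

end IsCompactBody

/-! ### Reduction of a general convex body to its closure. -/

theorem IsPlanarConvexBody.isCompactBody_closure {C : Set Plane} (hC : IsPlanarConvexBody C) :
    IsCompactBody (closure C) where
  convex := hC.convex.closure
  compact := hC.bounded.isCompact_closure
  interior_nonempty := hC.interior_nonempty.mono (interior_mono subset_closure)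

/-- A convex set with nonempty interior has the same interior, hence the same frontier, as its
closure, and infima of continuous functions do not change under closure. -/
theorem IsPlanarConvexBody.perimeterPortion_closure {C : Set Plane} (hC : IsPlanarConvexBody C)
    (I : Set Real.Angle) : perimeterPortion (closure C) I = perimeterPortion C I := by
  have h1 : frontier (closure C) = frontier C := by
    unfold frontier
    rw [closure_closure,
      hC.convex.interior_closure_eq_interior_of_nonempty_interior hC.interior_nonempty]
  have h2 : ∀ x, normals (closure C) x = normals C x := by
    intro x
    ext θ
    have hc : Continuous fun a : Plane => inner ℝ a (unitVec θ) := by fun_prop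
    have hl : lowerBounds ((fun a : Plane => inner ℝ a (unitVec θ)) '' closure C)
        = lowerBounds ((fun a : Plane => inner ℝ a (unitVec θ)) '' C) := by
      apply le_antisymm (lowerBounds_mono_set (Set.image_mono subset_closure))
      intro m hm
      rw [← lowerBounds_closure] at hm
      exact lowerBounds_mono_set (image_closure_subset_closure_image hc) hm
    unfold normals IsGLB
    rw [Set.mem_ofPred_eq, Set.mem_ofPred_eq, hl]
  unfold perimeterPortion
  rw [h1]
  simp only [h2]

/-- The frontier of a convex set has zero area, so the transforms coincide. -/
theorem IsPlanarConvexBody.fourierAverage_closure {C : Set Plane} (hC : IsPlanarConvexBody C)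
    (α β ρ : ℝ) : fourierAverage (closure C) α β ρ = fourierAverage C α β ρ := by
  have hae : ∀ δ : ℝ, (δ • closure C : Set Plane) =ᵐ[volume] (δ • C : Set Plane) := by
    intro δ
    have hsub : δ • C ⊆ δ • closure C := Set.smul_set_mono subset_closure
    have hz : volume (δ • closure C \ δ • C) = 0 := by
      refine measure_mono_null ?_ ((hC.convex.smul δ).addHaar_frontier volume)
      rintro x ⟨hx, hx'⟩
      exact ⟨smul_closure_subset δ C hx, fun h => hx' (interior_subset h)⟩
    exact (ae_le_set.2 hz).antisymm hsub.eventuallyLE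
  unfold fourierAverage
  simp only [charFourier_congr_ae (hae _)]

theorem lemma3p2 :
    ∃ c₁ c₂ : ℝ, 0 < c₁ ∧ 0 < c₂ ∧
      ∀ C : Set Plane, IsPlanarConvexBody C →
      ∀ α β : ℝ, α < β → β ≤ α + 2 * Real.pi →
      ∀ P : ℝ, P = perimeterPortion C (angleIcc α β)
          + perimeterPortion C ((fun θ : Real.Angle => θ + (Real.pi : Real.Angle)) '' angleIcc α β) →
        (P ≠ 0 → ∀ᶠ ρ : ℝ in atTop,
          c₁ * (ρ⁻¹ ^ 3 * P) ≤ fourierAverage C α β ρ ∧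
          fourierAverage C α β ρ ≤ c₂ * (ρ⁻¹ ^ 3 * P)) ∧
        (P = 0 → Tendsto (fun ρ : ℝ => ρ ^ 3 * fourierAverage C α β ρ) atTop (𝓝 0)) := by
  obtain ⟨c₀, K, hc₀, _, hlow⟩ := IsConcaveProfile.le_average
  refine ⟨c₀ / 20, 144, by positivity, by norm_num, ?_⟩
  intro C hC α β hαβ hβ P hP
  rw [angleIcc_add_pi, ← hC.perimeterPortion_closure, ← hC.perimeterPortion_closure] at hP
  simp only [← hC.fourierAverage_closure]
  exact hC.isCompactBody_closure.asymptotic_bounds hc₀ hlow hαβ hβ hP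

end
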